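/- Let $N_d$ be the group of $(d+1)\times(d+1)$ lower-triangular integer matrices with all diagonal entries equal to $1$. It acts linearly on $\mathbb{Z}^{d+1}$ preserving $\{1\}\times\mathbb{Z}^d$, hence it acts on $\mathbb{Z}^d$. A Farb–Franks action of $N_d$ is an action $\phi_{FF}$ on $[0,1]$ by orientation-preserving homeomorphisms for which there is a family of nondegenerate closed intervals $I_v\subset[0,1]$, $v\in\mathbb{Z}^d$, with pairwise disjoint interiors, of total length $\sum_v|I_v|=1$ and placed in $[0,1]$ in the lexicographic order of their indices, such that every $g\in N_d$ maps each $I_v$ onto $I_{g(v)}$, by a map that depends only on $v$ and $g(v)$ (so an element that preserves $I_v$ is the identity on $I_v$). (Such actions exist, and the original $C^1$ action of Farb and Franks is one of them.) For $\alpha>0$, a $C^1$-diffeomorphism $f$ of $[0,1]$ is called a $C^{1+\alpha}$-diffeomorphism if there is a constant $M$ with $|f'(x)-f'(y)|\le M|x-y|^{\alpha}$ for all $x,y\in[0,1]$. Theorem A. If $d\ge 3$ and $\alpha>\frac{2}{d(d-1)}$, then no Farb–Franks action $\phi_{FF}$ of $N_d$ is topologically conjugate to an action of $N_d$ on $[0,1]$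 by $C^{1+\alpha}$-diffeomorphisms. -/

import Mathlib

open scoped unitInterval

namespace FarbFranks

/-- The group of `(d+1) × (d+1)` lower-triangular integer matrices whose diagonal entries
are all equal to `1`. -/
def N (d : ℕ) : Subgroup (Matrix.SpecialLinearGroup (Fin (d + 1)) ℤ) where
  carrier := {A | (∀ i, A i i = 1) ∧ ∀ i j, i < j → A i j = 0}
  one_mem' := by
    refine ⟨fun i => ?_, fun i j h => ?_⟩
    · simp
    · simp [Matrix.one_apply_ne h.ne]
  mul_mem' := by
    rintro A B ⟨hA1, hA0⟩ ⟨hB1, hB0⟩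
    refine ⟨fun i => ?_, fun i j h => ?_⟩
    · rw [Matrix.SpecialLinearGroup.coe_mul, Matrix.mul_apply, Finset.sum_eq_single i]
      · rw [hA1, hB1, one_mul]
      · intro k _ hk
        rcases lt_or_gt_of_ne hk with h | h
        · rw [hB0 k i h, mul_zero]
        · rw [hA0 i k h, zero_mul]
      · simp
    · rw [Matrix.SpecialLinearGroup.coe_mul, Matrix.mul_apply]
      refine Finset.sum_eq_zero fun k _ => ?_
      rcases lt_or_ge i k with hk | hk
      · rw [hA0 i k hk, zero_mul]
      · rw [hB0 k j (lt_of_le_of_lt hk h), mul_zero]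
  inv_mem' := by
    rintro A ⟨hA1, hA0⟩
    have hmul : (A : Matrix (Fin (d + 1)) (Fin (d + 1)) ℤ) * (A⁻¹ : _) = 1 := by
      rw [← Matrix.SpecialLinearGroup.coe_mul, mul_inv_cancel, Matrix.SpecialLinearGroup.coe_one]
    have hmul' : ((A⁻¹ : Matrix.SpecialLinearGroup (Fin (d + 1)) ℤ) :
        Matrix (Fin (d + 1)) (Fin (d + 1)) ℤ) * A = 1 := by
      rw [← Matrix.SpecialLinearGroup.coe_mul, inv_mul_cancel, Matrix.SpecialLinearGroup.coe_one]
    have h0 : ∀ i j, i < j → (A⁻¹ : Matrix.SpecialLinearGroup (Fin (d + 1)) ℤ) i j = 0 := by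
      let _ : Invertible (A : Matrix (Fin (d + 1)) (Fin (d + 1)) ℤ) := ⟨_, hmul', hmul⟩
      have hb : Matrix.BlockTriangular (A : Matrix (Fin (d + 1)) (Fin (d + 1)) ℤ)
          OrderDual.toDual := fun i j h => hA0 i j h
      have h := Matrix.blockTriangular_inv_of_blockTriangular hb
      rw [Matrix.inv_eq_left_inv hmul'] at h
      exact fun i j hij => h hij
    refine ⟨fun i => ?_, h0⟩
    have h := congrFun (congrFun hmul i) i
    rw [Matrix.mul_apply, Finset.sum_eq_single i, hA1, one_mul, Matrix.one_apply_eq] at h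
    · exact h
    · intro k _ hk
      rcases lt_or_gt_of_ne hk with h | h
      · rw [h0 k i h, mul_zero]
      · rw [hA0 i k h, zero_mul]
    · simp

/-- The action of `N d` on `ℤ^d` induced by its linear action on the invariant affine hyperplane
`1 × ℤ^d` of `ℤ^(d+1)`: if `A (1, v) = (1, w)`, then `act A v = w`. -/
def act {d : ℕ} (A : N d) (v : Fin d → ℤ) : Fin d → ℤ :=
  Fin.tail (Matrix.mulVec (A : Matrix.SpecialLinearGroup (Fin (d + 1)) ℤ).1
    (Fin.cons 1 v : Fin (d + 1) → ℤ))

/-- The hyperplane `1 × ℤ^d` is indeed invariant. -/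
theorem cons_act {d : ℕ} (A : N d) (v : Fin d → ℤ) :
    (Fin.cons 1 (act A v) : Fin (d + 1) → ℤ) =
      Matrix.mulVec (A : Matrix.SpecialLinearGroup (Fin (d + 1)) ℤ).1 (Fin.cons 1 v) := by
  have h : (Matrix.mulVec (A : Matrix.SpecialLinearGroup (Fin (d + 1)) ℤ).1
      (Fin.cons 1 v : Fin (d + 1) → ℤ)) 0 = 1 := by
    have h1 := A.2.1 0
    have h0 := A.2.2 0
    rw [Matrix.mulVec, dotProduct, Fin.sum_univ_succ, Finset.sum_eq_zero]
    · simpa using h1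
    · intro j _
      rw [h0 j.succ (Fin.succ_pos j), zero_mul]
  unfold act
  conv_rhs => rw [← Fin.cons_self_tail (Matrix.mulVec _ _), h]

theorem act_one {d : ℕ} (v : Fin d → ℤ) : act (1 : N d) v = v := by
  simp [act]

theorem act_mul {d : ℕ} (A B : N d) (v : Fin d → ℤ) : act (A * B) v = act A (act B v) := by
  conv_rhs => rw [act, cons_act, Matrix.mulVec_mulVec]
  rfl

/-- The family of intervals `I_v = [a v, b v]`, `v ∈ ℤ^d`, is nondegenerate, has total length `1`,
and is joined lexicographically on `[0,1]`. -/
structure IsLexFamily {d : ℕ} (a b : (Fin d → ℤ) → I) : Prop where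
  lt : ∀ v, a v < b v
  lex : ∀ v w, toLex v < toLex w → b v ≤ a w
  total : HasSum (fun v => (b v : ℝ) - (a v : ℝ)) 1

/-- `φ` is a Farb–Franks action: it is an action of `N d` by orientation-preserving homeomorphisms
of `[0,1]` for which there is a family of intervals `I_v`, `v ∈ ℤ^d`, of total length `1`, joined
lexicographically on `[0,1]`, such that each `g` sends `I_v` onto `I_(g v)`, by a map which
depends only on the two intervals (so that the maps used form an equivariant family, and elements
preserving an interval `I_v` act trivially on it). -/
def IsFarbFranksAction (d : ℕ) (φ : N d →* (I ≃ₜ I)) : Prop :=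
  (∀ g, Monotone (φ g)) ∧
  ∃ a b : (Fin d → ℤ) → I, IsLexFamily a b ∧
    (∀ g v, φ g '' Set.Icc (a v) (b v) = Set.Icc (a (act g v)) (b (act g v))) ∧
    ∀ g h v, act g v = act h v → Set.EqOn (φ g) (φ h) (Set.Icc (a v) (b v))

/-- A homeomorphism `f` of `[0,1]` is a `C^(1+α)`-diffeomorphism: it has a continuous, nowhere zero
derivative `f'` (one-sided at the end-points), and `|f' x - f' y| ≤ M |x - y|^α` for some `M`. -/
def IsHolderDiffeo (α : ℝ) (f : I ≃ₜ I) : Prop :=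
  ∃ f' : I → ℝ,
    (∀ x : I, HasDerivWithinAt (Set.IccExtend (zero_le_one' ℝ) fun t => (f t : ℝ)) (f' x)
      (Set.Icc 0 1) x) ∧
    Continuous f' ∧ (∀ x, f' x ≠ 0) ∧
    ∃ M : ℝ, ∀ x y : I, |f' x - f' y| ≤ M * |(x : ℝ) - (y : ℝ)| ^ α

/-- Two actions on `[0,1]` are topologically conjugate. -/
def TopConjugate {G : Type*} [Group G] (φ ψ : G →* (I ≃ₜ I)) : Prop :=
  ∃ h : I ≃ₜ I, ∀ g x, h (φ g x) = ψ g (h x)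

/-! The remaining facts show that Farb–Franks actions exist, by using affine maps between the
intervals. -/

section

open scoped Classical

theorem act_apply {d : ℕ} (A : N d) (v : Fin d → ℤ) (k : Fin d) :
    act A v k = (A : Matrix.SpecialLinearGroup (Fin (d + 1)) ℤ) k.succ 0 +
      ∑ j : Fin d, (A : Matrix.SpecialLinearGroup (Fin (d + 1)) ℤ) k.succ j.succ * v j := by
  simp [act, Fin.tail, Matrix.mulVec, dotProduct, Fin.sum_univ_succ]

theorem act_lt_act {d : ℕ} (A : N d) {v w : Fin d → ℤ} (h : toLex v < toLex w) :
    toLex (act A v) < toLex (act A w) := by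
  obtain ⟨i, hi, hlt⟩ := h
  have key : ∀ k, (∀ j, j < k → v j = w j) → act A w k - act A v k = w k - v k := by
    intro k hk
    rw [act_apply, act_apply, add_sub_add_left_eq_sub, ← Finset.sum_sub_distrib,
      Finset.sum_eq_single k]
    · rw [A.2.1 k.succ, one_mul, one_mul]
    · intro j _ hj
      rcases lt_or_gt_of_ne hj with h | h
      · rw [hk j h, sub_self]
      · rw [A.2.2 k.succ j.succ (Fin.succ_lt_succ_iff.2 h), zero_mul, zero_mul, sub_self]
    · simp
  refine ⟨i, fun j hj => ?_, ?_⟩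
  · have h1 := key j (fun m hm => hi m (hm.trans hj))
    have h2 : v j = w j := hi j hj
    change act A v j = act A w j
    omega
  · have h1 := key i hi
    have h2 : v i < w i := hlt
    change act A v i < act A w i
    omega

theorem lex_irrefl {d : ℕ} (v : Fin d → ℤ) : ¬ toLex v < toLex v := fun ⟨_, _, h⟩ => lt_irrefl _ h

theorem lex_trans {d : ℕ} {u v w : Fin d → ℤ} (h : toLex u < toLex v) (h' : toLex v < toLex w) :
    toLex u < toLex w := Pi.Lex.isStrictOrder.trans _ _ _ h h'

theorem lex_trichotomy {d : ℕ} (v w : Fin d → ℤ) :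
    toLex v < toLex w ∨ v = w ∨ toLex w < toLex v :=
  @lt_trichotomy (Lex (Fin d → ℤ)) _ (toLex v) (toLex w)

theorem act_lt_act_iff {d : ℕ} (A : N d) {v w : Fin d → ℤ} :
    toLex (act A v) < toLex (act A w) ↔ toLex v < toLex w := by
  refine ⟨fun h => ?_, act_lt_act A⟩
  have := act_lt_act A⁻¹ h
  rwa [← act_mul, ← act_mul, inv_mul_cancel, act_one, act_one] at this

def actEquiv {d : ℕ} (A : N d) : (Fin d → ℤ) ≃ (Fin d → ℤ) where
  toFun := act A
  invFun := act A⁻¹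
  left_inv v := by rw [← act_mul, inv_mul_cancel, act_one]
  right_inv v := by rw [← act_mul, mul_inv_cancel, act_one]

noncomputable def left {d : ℕ} (l : (Fin d → ℤ) → ℝ) (v : Fin d → ℤ) : ℝ :=
  ∑' w, if toLex w < toLex v then l w else 0

noncomputable def clamp (t : ℝ) : ℝ := max 0 (min t 1)

theorem clamp_nonneg (t : ℝ) : 0 ≤ clamp t := le_max_left _ _
theorem clamp_le_one (t : ℝ) : clamp t ≤ 1 := max_le zero_le_one (min_le_right _ _)
theorem clamp_mono : Monotone clamp := fun _ _ h => max_le_max le_rfl (min_le_min h le_rfl)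
theorem clamp_of_le {t : ℝ} (h : t ≤ 0) : clamp t = 0 := max_eq_left (min_le_of_left_le h)
theorem clamp_of_ge {t : ℝ} (h : 1 ≤ t) : clamp t = 1 := by simp [clamp, h]
theorem clamp_of_mem {t : ℝ} (h0 : 0 ≤ t) (h1 : t ≤ 1) : clamp t = t := by simp [clamp, h0, h1]
theorem continuous_clamp : Continuous clamp := by unfold clamp; fun_prop

/-- The increasing map of `[0,1]` that sends each `I_w` affinely onto `I_(A w)`. -/
noncomputable def affineMap {d : ℕ} (l : (Fin d → ℤ) → ℝ) (A : N d) (x : ℝ) : ℝ :=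
  ∑' w, l (act A w) * clamp ((x - left l w) / l w)

section

variable {d : ℕ} {l : (Fin d → ℤ) → ℝ}

theorem summable_left (hp : ∀ v, 0 < l v) (hs : HasSum l 1) (v : Fin d → ℤ) :
    Summable fun w => if toLex w < toLex v then l w else 0 := by
  refine Summable.of_nonneg_of_le (fun w => ?_) (fun w => ?_) hs.summable
  · split_ifs <;> simp [(hp w).le]
  · split_ifs <;> simp [(hp w).le]

theorem left_nonneg (hp : ∀ v, 0 < l v) (v : Fin d → ℤ) : 0 ≤ left l v :=
  tsum_nonneg fun w => by split_ifs <;> simp [(hp w).le]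

theorem left_add_le (hp : ∀ v, 0 < l v) (hs : HasSum l 1) {v w : Fin d → ℤ}
    (h : toLex v < toLex w) : left l v + l v ≤ left l w := by
  have h1 : HasSum (fun u => (if toLex u < toLex v then l u else 0) + if u = v then l v else 0)
      (left l v + l v) := (summable_left hp hs v).hasSum.add (hasSum_ite_eq v (l v))
  refine hasSum_le (fun u => ?_) h1 (summable_left hp hs w).hasSum
  by_cases huv : u = v
  · subst huv
    rw [if_neg (lex_irrefl u), if_pos rfl, if_pos h, zero_add]
  · simp only [huv, if_false, add_zero]
    split_ifs with h1 h2
    · exact le_rfl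
    · exact absurd (lex_trans h1 h) h2
    · exact (hp u).le
    · exact le_rfl

theorem left_add_le_one (hp : ∀ v, 0 < l v) (hs : HasSum l 1) (v : Fin d → ℤ) :
    left l v + l v ≤ 1 := by
  have h1 : HasSum (fun u => (if toLex u < toLex v then l u else 0) + if u = v then l v else 0)
      (left l v + l v) := (summable_left hp hs v).hasSum.add (hasSum_ite_eq v (l v))
  refine hasSum_le (fun u => ?_) h1 hs
  by_cases huv : u = v
  · subst huv
    rw [if_neg (lex_irrefl u), if_pos rfl, zero_add]
  · simp only [huv, if_false, add_zero]
    split_ifs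
    exacts [le_rfl, (hp u).le]

theorem hasSum_act (hs : HasSum l 1) (A : N d) : HasSum (fun w => l (act A w)) 1 :=
  (actEquiv A).hasSum_iff.2 hs

theorem left_act (A : N d) (v : Fin d → ℤ) :
    left l (act A v) = ∑' w, if toLex w < toLex v then l (act A w) else 0 := by
  rw [left, ← (actEquiv A).tsum_eq]
  refine tsum_congr fun w => ?_
  change (if toLex (act A w) < toLex (act A v) then l (act A w) else 0) = _
  simp only [act_lt_act_iff]

theorem summable_affineMap (hp : ∀ v, 0 < l v) (hs : HasSum l 1) (A : N d) (x : ℝ) :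
    Summable fun w => l (act A w) * clamp ((x - left l w) / l w) :=
  Summable.of_nonneg_of_le (fun _ => mul_nonneg (hp _).le (clamp_nonneg _))
    (fun _ => mul_le_of_le_one_right (hp _).le (clamp_le_one _)) (hasSum_act hs A).summable

theorem continuous_affineMap (hp : ∀ v, 0 < l v) (hs : HasSum l 1) (A : N d) :
    Continuous (affineMap l A) := by
  refine continuous_tsum (fun _ => ?_) (hasSum_act hs A).summable fun _ x => ?_
  · exact continuous_const.mul (continuous_clamp.comp (by fun_prop))
  · rw [Real.norm_eq_abs, abs_of_nonneg (mul_nonneg (hp _).le (clamp_nonneg _))]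
    exact mul_le_of_le_one_right (hp _).le (clamp_le_one _)

theorem monotone_affineMap (hp : ∀ v, 0 < l v) (hs : HasSum l 1) (A : N d) :
    Monotone (affineMap l A) := fun x y h =>
  (summable_affineMap hp hs A x).tsum_le_tsum
    (fun _ => mul_le_mul_of_nonneg_left
      (clamp_mono (div_le_div_of_nonneg_right (sub_le_sub_right h _) (hp _).le)) (hp _).le)
    (summable_affineMap hp hs A y)

theorem affineMap_mem (hp : ∀ v, 0 < l v) (hs : HasSum l 1) (A : N d) (x : ℝ) :
    affineMap l A x ∈ Set.Icc (0 : ℝ) 1 :=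
  ⟨tsum_nonneg fun _ => mul_nonneg (hp _).le (clamp_nonneg _),
    hasSum_le (fun _ => mul_le_of_le_one_right (hp _).le (clamp_le_one _))
      (summable_affineMap hp hs A x).hasSum (hasSum_act hs A)⟩

theorem affineMap_apply (hp : ∀ v, 0 < l v) (hs : HasSum l 1) (A : N d) (v : Fin d → ℤ) {t : ℝ}
    (h0 : 0 ≤ t) (h1 : t ≤ 1) :
    affineMap l A (left l v + t * l v) = left l (act A v) + t * l (act A v) := by
  rw [left_act, affineMap]
  have hsum : Summable fun w => if toLex w < toLex v then l (act A w) else 0 := by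
    refine Summable.of_nonneg_of_le (fun w => ?_) (fun w => ?_) (hasSum_act hs A).summable
    · split_ifs <;> simp [(hp _).le]
    · split_ifs <;> simp [(hp _).le]
  rw [← (hsum.hasSum.add (hasSum_ite_eq v (t * l (act A v)))).tsum_eq]
  refine tsum_congr fun w => ?_
  have hw := hp w
  have hv := hp v
  rcases lex_trichotomy w v with h | h | h
  · have hle := left_add_le hp hs h
    have hne : w ≠ v := fun e => lex_irrefl v (e ▸ h)
    rw [clamp_of_ge, if_pos h, if_neg hne, mul_one, add_zero]
    rw [le_div_iff₀ hw]
    nlinarith [mul_nonneg h0 hv.le]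
  · subst h
    rw [if_neg (lex_irrefl _), if_pos rfl, add_sub_cancel_left, mul_div_cancel_right₀ _ hw.ne',
      clamp_of_mem h0 h1, zero_add, mul_comm]
  · have hle := left_add_le hp hs h
    have hne : w ≠ v := fun e => lex_irrefl v (e ▸ h)
    have hnot : ¬ toLex w < toLex v := fun h' => lex_irrefl v (lex_trans h h')
    rw [clamp_of_le, if_neg hnot, if_neg hne, mul_zero, add_zero]
    refine div_nonpos_of_nonpos_of_nonneg ?_ hw.le
    nlinarith [mul_le_mul_of_nonneg_right h1 hv.le]

theorem exists_param (hp : ∀ v, 0 < l v) {v : Fin d → ℤ} {x : ℝ}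
    (hx : x ∈ Set.Icc (left l v) (left l v + l v)) :
    ∃ t, 0 ≤ t ∧ t ≤ 1 ∧ x = left l v + t * l v := by
  have hv := hp v
  refine ⟨(x - left l v) / l v, div_nonneg (sub_nonneg.2 hx.1) hv.le, ?_, ?_⟩
  · rw [div_le_one hv]
    linarith [hx.2]
  · rw [div_mul_cancel₀ _ hv.ne']
    ring

/-- The intervals fill up a dense subset of `[0,1]`. -/
theorem exists_mem_Ioo (hp : ∀ v, 0 < l v) (hs : HasSum l 1) {x y : ℝ} (hx : 0 ≤ x) (hxy : x < y)
    (hy : y ≤ 1) : ∃ z ∈ Set.Ioo x y, ∃ v, z ∈ Set.Icc (left l v) (left l v + l v) := by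
  by_contra! hcon
  let U : Set ℝ := ⋃ v, Set.Ioo (left l v) (left l v + l v)
  have hdisj : Disjoint U (Set.Ioo x y) := by
    rw [Set.disjoint_left]
    intro z hz hz'
    obtain ⟨v, hv⟩ := Set.mem_iUnion.1 hz
    exact hcon z hz' v (Set.Ioo_subset_Icc_self hv)
  have hU : MeasureTheory.volume U = 1 := by
    rw [MeasureTheory.measure_iUnion]
    · simp only [Real.volume_Ioo, add_sub_cancel_left]
      rw [← ENNReal.ofReal_tsum_of_nonneg (fun v => (hp v).le) hs.summable, hs.tsum_eq,
        ENNReal.ofReal_one]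
    · intro v w hvw
      refine Set.disjoint_left.2 fun z hz hz' => ?_
      rcases lex_trichotomy v w with h | h | h
      · linarith [left_add_le hp hs h, hz.2, hz'.1]
      · exact absurd h hvw
      · linarith [left_add_le hp hs h, hz.1, hz'.2]
    · exact fun v => measurableSet_Ioo
  have hsub : U ∪ Set.Ioo x y ⊆ Set.Icc 0 1 := by
    refine Set.union_subset (Set.iUnion_subset fun v z hz => ?_) fun z hz => ?_
    · exact ⟨(left_nonneg hp v).trans hz.1.le, hz.2.le.trans (left_add_le_one hp hs v)⟩
    · exact ⟨hx.trans hz.1.le, hz.2.le.trans hy⟩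
  have h := MeasureTheory.measure_mono (μ := MeasureTheory.volume) hsub
  rw [MeasureTheory.measure_union hdisj measurableSet_Ioo, hU, Real.volume_Ioo, Real.volume_Icc,
    sub_zero, ENNReal.ofReal_one] at h
  have hpos : 0 < ENNReal.ofReal (y - x) := ENNReal.ofReal_pos.2 (sub_pos.2 hxy)
  exact absurd h (not_le.2 (ENNReal.lt_add_right ENNReal.one_ne_top hpos.ne'))

/-- Two continuous maps that agree on all the intervals agree on `[0,1]`. -/
theorem eq_of_eq_on_intervals (hp : ∀ v, 0 < l v) (hs : HasSum l 1) {F G : ℝ → ℝ}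
    (hF : Continuous F) (hG : Continuous G)
    (h : ∀ v t, 0 ≤ t → t ≤ 1 → F (left l v + t * l v) = G (left l v + t * l v)) {x : ℝ}
    (hx : x ∈ Set.Icc (0 : ℝ) 1) : F x = G x := by
  have hcl : IsClosed {x | F x = G x} := isClosed_eq hF hG
  have hIoo : Set.Ioo (0 : ℝ) 1 ⊆ {x | F x = G x} := by
    intro z hz
    rw [← hcl.closure_eq, Metric.mem_closure_iff]
    intro ε hε
    obtain ⟨u, hu, v, huv⟩ := exists_mem_Ioo hp hs hz.1.le
      (lt_min (lt_add_of_pos_right z hε) hz.2) (min_le_right (z + ε) 1)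
    obtain ⟨t, h0, h1, rfl⟩ := exists_param hp huv
    refine ⟨_, h v t h0 h1, ?_⟩
    rw [Real.dist_eq, abs_sub_lt_iff]
    constructor <;> linarith [hu.1, hu.2, min_le_left (z + ε) 1]
  have := closure_minimal hIoo hcl
  rw [closure_Ioo zero_ne_one] at this
  exact this hx

theorem affineMap_mul (hp : ∀ v, 0 < l v) (hs : HasSum l 1) (A B : N d) {x : ℝ}
    (hx : x ∈ Set.Icc (0 : ℝ) 1) : affineMap l (A * B) x = affineMap l A (affineMap l B x) := by
  refine eq_of_eq_on_intervals hp hs (continuous_affineMap hp hs _)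
    ((continuous_affineMap hp hs A).comp (continuous_affineMap hp hs B)) (fun v t h0 h1 => ?_) hx
  rw [Function.comp_apply, affineMap_apply hp hs _ _ h0 h1, affineMap_apply hp hs _ _ h0 h1,
    affineMap_apply hp hs _ _ h0 h1, act_mul]

theorem affineMap_one (hp : ∀ v, 0 < l v) (hs : HasSum l 1) {x : ℝ}
    (hx : x ∈ Set.Icc (0 : ℝ) 1) : affineMap l 1 x = x := by
  refine eq_of_eq_on_intervals hp hs (continuous_affineMap hp hs _)
    continuous_id (fun v t h0 h1 => ?_) hx
  rw [affineMap_apply hp hs _ _ h0 h1, act_one, id]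

/-- The action of `N d` on `[0,1]` by the maps that are affine on the intervals. -/
noncomputable def affineAction (hp : ∀ v, 0 < l v) (hs : HasSum l 1) : N d →* (I ≃ₜ I) where
  toFun A :=
    { toFun := fun x => ⟨affineMap l A x, affineMap_mem hp hs A x⟩
      invFun := fun x => ⟨affineMap l A⁻¹ x, affineMap_mem hp hs A⁻¹ x⟩
      left_inv := fun x => Subtype.ext (by
        change affineMap l A⁻¹ (affineMap l A x) = x
        rw [← affineMap_mul hp hs _ _ x.2, inv_mul_cancel, affineMap_one hp hs x.2])
      right_inv := fun x => Subtype.ext (by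
        change affineMap l A (affineMap l A⁻¹ x) = x
        rw [← affineMap_mul hp hs _ _ x.2, mul_inv_cancel, affineMap_one hp hs x.2])
      continuous_toFun :=
        ((continuous_affineMap hp hs A).comp continuous_subtype_val).subtype_mk _
      continuous_invFun :=
        ((continuous_affineMap hp hs A⁻¹).comp continuous_subtype_val).subtype_mk _ }
  map_one' := Homeomorph.ext fun x => Subtype.ext (affineMap_one hp hs x.2)
  map_mul' A B := Homeomorph.ext fun x => Subtype.ext (affineMap_mul hp hs A B x.2)

theorem isFarbFranksAction_affineAction (hp : ∀ v, 0 < l v) (hs : HasSum l 1) :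
    IsFarbFranksAction d (affineAction hp hs) := by
  have hmem : ∀ v, left l v + l v ∈ I := fun v =>
    ⟨add_nonneg (left_nonneg hp v) (hp v).le, left_add_le_one hp hs v⟩
  have hmem' : ∀ v, left l v ∈ I := fun v =>
    ⟨left_nonneg hp v, (le_add_of_nonneg_right (hp v).le).trans (hmem v).2⟩
  have hsub : ∀ g v (x : I), x ∈ Set.Icc (⟨left l v, hmem' v⟩ : I) ⟨left l v + l v, hmem v⟩ →
      affineAction hp hs g x ∈
        Set.Icc (⟨left l (act g v), hmem' _⟩ : I) ⟨left l (act g v) + l (act g v), hmem _⟩ := by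
    intro g v x hx
    obtain ⟨t, h0, h1, ht⟩ := exists_param hp (v := v) (x := x) hx
    have h : affineMap l g x = left l (act g v) + t * l (act g v) := by
      rw [ht, affineMap_apply hp hs g v h0 h1]
    have hl := hp (act g v)
    constructor
    · change left l (act g v) ≤ affineMap l g x
      rw [h]
      exact le_add_of_nonneg_right (mul_nonneg h0 hl.le)
    · change affineMap l g x ≤ left l (act g v) + l (act g v)
      rw [h]
      exact add_le_add_right (mul_le_of_le_one_left hl.le h1) _
  refine ⟨fun g x y h => monotone_affineMap hp hs g h, fun v => ⟨left l v, hmem' v⟩,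
    fun v => ⟨left l v + l v, hmem v⟩, ⟨fun v => ?_, fun v w h => ?_, ?_⟩, fun g v => ?_,
    fun g h v hgh x hx => ?_⟩
  · exact Subtype.mk_lt_mk.2 (lt_add_of_pos_right _ (hp v))
  · exact Subtype.mk_le_mk.2 (left_add_le hp hs h)
  · simpa using hs
  · refine Set.Subset.antisymm (Set.image_subset_iff.2 fun x hx => hsub g v x hx) fun y hy => ?_
    refine ⟨affineAction hp hs g⁻¹ y, ?_, ?_⟩
    · have := hsub g⁻¹ (act g v) y hy
      simp only [← act_mul, inv_mul_cancel, act_one] at this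
      exact this
    · rw [← Homeomorph.mul_apply, ← map_mul, mul_inv_cancel, map_one, Homeomorph.one_apply]
  · obtain ⟨t, h0, h1, ht⟩ := exists_param hp (v := v) (x := x) hx
    refine Subtype.ext ?_
    change affineMap l g x = affineMap l h x
    rw [ht, affineMap_apply hp hs g v h0 h1, affineMap_apply hp hs h v h0 h1, hgh]

end

end

theorem exists_isFarbFranksAction (d : ℕ) : ∃ φ, IsFarbFranksAction d φ := by
  let _ := Encodable.ofCountable (Fin d → ℤ)
  obtain ⟨l, hp, c, hc, -⟩ := posSumOfEncodable one_pos (Fin d → ℤ)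
  have hc0 : 0 < c := (hp 0).trans_le (le_hasSum hc 0 fun v _ => (hp v).le)
  have hs : HasSum (fun v => l v / c) 1 := by
    have := hc.div_const c
    rwa [div_self hc0.ne'] at this
  exact ⟨_, isFarbFranksAction_affineAction (fun v => div_pos (hp v) hc0) hs⟩

end FarbFranks

namespace FarbFranks

/-! Suppose that a homeomorphism `h` conjugates the action to a `C^(1+α)` action, and put `d = m +
1` and `β = min α 1`. A row is the set of points that differ only in the last coordinate. Let `rho
v` be the length of `h(I_v)`, and `lam v` the length of the hull of the images under `h` of the
intervals in the row of `v`. Distinct rows have disjoint interiors, so the `lam` of distinct rows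
sum to at most `1`.

Each group element maps rows to rows. By Hölder continuity of the derivative, it changes the ratio
of the lengths of two intervals in the row of `v` by a factor of at most `exp (C * lam v ^ β)`.
Along a path of generators these factors multiply, and the total distortion is bounded in terms of
the sum of `lam ^ β`, the cost of the path. A central translation fixes the end-points of every row,
so it is nearly an isometry on a short row. A long path of bounded cost from the origin visits a
short row. Comparison there and transport back to the origin bound `rho` of every central translate
of the origin from below by one positive constant (`false_of_distortion`). This is absurd, since
these intervals are infinitely many and disjoint.

Long paths of bounded cost come from averaging (`exists_long_word`). Blocks of length of order `L`
reach `L ^ D` distinct rows, where `D = d (d - 1) / 2`, because their digits can be read off from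
the row of the end-point (`blockWord_injective`). Hölder's inequality bounds the mean of `lam ^ β`
over these rows by `L ^ (-β D)`. With `L = 2 ^ k`, the mean cost of the next block is of order `2 ^
(k (1 - β D))`, which is summable exactly when `β D > 1`. -/

/-! ### Elementary matrices and the coordinates they change -/

/-- The elementary matrix `1 + c E_(i,j)` with `j < i`, as an element of `N d`. -/
def elementary {d : ℕ} (i j : Fin (d + 1)) (h : j < i) (c : ℤ) : N d :=
  ⟨Matrix.SpecialLinearGroup.transvection h.ne' c, by
    refine ⟨fun k => ?_, fun k l hkl => ?_⟩
    · have : ¬ (i = k ∧ j = k) := fun ⟨h1, h2⟩ => h.ne (h2.trans h1.symm)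
      simp [Matrix.SpecialLinearGroup.transvection, Matrix.transvection, this]
    · have : ¬ (i = k ∧ j = l) := by
        rintro ⟨rfl, rfl⟩
        exact absurd h hkl.not_gt
      simp [Matrix.SpecialLinearGroup.transvection, Matrix.transvection, this,
        Matrix.one_apply_ne hkl.ne]⟩

/-- The elementary matrix that adds `c` times the coordinate number `j` to the coordinate number
`i + 1`. -/
def gen (d i j : ℕ) (c : ℤ) : N d :=
  -- Natural indices, with a junk value off the triangle, allow recursive definitions of words that
  -- carry no bounds.
  if h : j ≤ i ∧ i < d then
    elementary (⟨i + 1, by omega⟩ : Fin (d + 1)) ⟨j, by omega⟩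
      (by simp only [Fin.mk_lt_mk]; omega) c
  else 1

/-- The coordinates of the point `(1, v)`, continued by zeros. -/
def coord {d : ℕ} (v : Fin d → ℤ) (t : ℕ) : ℤ :=
  if h : t < d + 1 then (Fin.cons 1 v : Fin (d + 1) → ℤ) ⟨t, h⟩ else 0

@[simp] theorem coord_zero {d : ℕ} (v : Fin d → ℤ) : coord v 0 = 1 := by
  simp [coord]

theorem coord_succ {d : ℕ} (v : Fin d → ℤ) (i : Fin d) : coord v (i + 1) = v i := by
  have : (⟨(i : ℕ) + 1, by omega⟩ : Fin (d + 1)) = i.succ := rfl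
  rw [coord, dif_pos (by omega), this, Fin.cons_succ]

theorem coord_nonneg {d : ℕ} {v : Fin d → ℤ} (h : 0 ≤ v) (t : ℕ) : 0 ≤ coord v t := by
  rcases t with _ | t
  · simp
  · by_cases ht : t < d
    · have := coord_succ v ⟨t, ht⟩
      simp only at this
      rw [this]
      exact h _
    · rw [coord, dif_neg (by omega)]

theorem coord_gen {d i j : ℕ} (hji : j ≤ i) (hi : i < d) (c : ℤ) (v : Fin d → ℤ) :
    coord (act (gen d i j c) v) =
      Function.update (coord v) (i + 1) (coord v (i + 1) + c * coord v j) := by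
  funext t
  by_cases ht : t < d + 1
  · have key : (Fin.cons 1 (act (gen d i j c) v) : Fin (d + 1) → ℤ) ⟨t, ht⟩ =
        (Fin.cons 1 v : Fin (d + 1) → ℤ) ⟨t, ht⟩ +
          if t = i + 1 then c * (Fin.cons 1 v : Fin (d + 1) → ℤ) ⟨j, by omega⟩ else 0 := by
      rw [cons_act, gen, dif_pos ⟨hji, hi⟩]
      change Matrix.mulVec (Matrix.transvection _ _ c) _ _ = _
      rw [Matrix.transvection, Matrix.add_mulVec, Matrix.one_mulVec, Pi.add_apply,
        Matrix.single_mulVec]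
      congr 1
      simp [Function.update_apply, Fin.ext_iff]
    rw [coord, dif_pos ht, key, Function.update_apply]
    split_ifs with h
    · subst h
      rw [coord, dif_pos ht, coord, dif_pos (show j < d + 1 by omega)]
    · rw [coord, dif_pos ht, add_zero]
  · rw [Function.update_of_ne (by omega), coord, dif_neg ht, coord, dif_neg ht]

/-! ### Words -/

/-- The end-point of the path that starts at `v` and follows the letters of a word. -/
def endpt {d : ℕ} : List (N d) → (Fin d → ℤ) → (Fin d → ℤ)
  | [], v => v
  | g :: w, v => endpt w (act g v)

@[simp] theorem endpt_nil {d : ℕ} (v : Fin d → ℤ) : endpt [] v = v := rfl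

@[simp] theorem endpt_cons {d : ℕ} (g : N d) (w : List (N d)) (v : Fin d → ℤ) :
    endpt (g :: w) v = endpt w (act g v) := rfl

theorem endpt_append {d : ℕ} (w w' : List (N d)) (v : Fin d → ℤ) :
    endpt (w ++ w') v = endpt w' (endpt w v) := by
  induction w generalizing v with
  | nil => rfl
  | cons g w ih => simp [ih]

/-- As `j < i + 1`, the letter does not alter coordinate `j`, so its repetitions add up linearly. -/
theorem coord_endpt_replicate {d i j : ℕ} (hji : j ≤ i) (hi : i < d) (n : ℕ) (v : Fin d → ℤ) :
    coord (endpt (List.replicate n (gen d i j 1)) v) =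
      Function.update (coord v) (i + 1) (coord v (i + 1) + n * coord v j) := by
  induction n generalizing v with
  | zero => simp
  | succ n ih =>
    rw [List.replicate_succ, endpt_cons, ih, coord_gen hji hi]
    have h : j ≠ i + 1 := by omega
    simp only [Function.update_self, Function.update_of_ne h, Function.update_idem]
    congr 1
    push_cast
    ring

/-- The word that adds `c j` times the coordinate `j` to the coordinate `i + 1`, for all `j < n`. -/
def digitWord (d i : ℕ) (c : ℕ → ℕ) : ℕ → List (N d)
  | 0 => []
  | n + 1 => digitWord d i c n ++ List.replicate (c n) (gen d i n 1)

theorem coord_endpt_digitWord {d i : ℕ} (hi : i < d) (c : ℕ → ℕ) {n : ℕ} (hn : n ≤ i + 1)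
    (v : Fin d → ℤ) :
    coord (endpt (digitWord d i c n) v) =
      Function.update (coord v) (i + 1)
        (coord v (i + 1) + ∑ j ∈ Finset.range n, c j * coord v j) := by
  induction n with
  | zero => simp [digitWord]
  | succ n ih =>
    rw [digitWord, endpt_append, coord_endpt_replicate (by omega) hi, ih (by omega)]
    have h : n ≠ i + 1 := by omega
    simp only [Function.update_self, Function.update_of_ne h, Function.update_idem]
    rw [Finset.sum_range_succ, add_assoc]

/-- The word that treats in this way the coordinates `1, …, n`, after having made them
at least `L` times larger than the preceding ones. -/
def blockWord (d L : ℕ) (c : ℕ → ℕ → ℕ) : ℕ → List (N d)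
  | 0 => []
  | n + 1 => blockWord d L c n ++
      (List.replicate L (gen d n n 1) ++ digitWord d n (c n) (n + 1))

theorem coord_endpt_blockWord_succ {d n : ℕ} (L : ℕ) (c : ℕ → ℕ → ℕ) (hn : n < d)
    (v : Fin d → ℤ) :
    coord (endpt (blockWord d L c (n + 1)) v) =
      Function.update (coord (endpt (blockWord d L c n) v)) (n + 1)
        (coord (endpt (blockWord d L c n) v) (n + 1) + L * coord (endpt (blockWord d L c n) v) n +
          ∑ j ∈ Finset.range (n + 1), c n j * coord (endpt (blockWord d L c n) v) j) := by
  rw [blockWord, endpt_append, endpt_append, coord_endpt_digitWord hn _ le_rfl,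
    coord_endpt_replicate le_rfl hn]
  simp only [Function.update_self, Function.update_idem]
  congr 2
  refine Finset.sum_congr rfl fun j hj => ?_
  rw [Function.update_of_ne (Finset.mem_range.1 hj).ne]

/-- When coordinate `t + 1` is treated, the lower ones already have their final values, and it is
not altered afterwards. Hence the digits enter only through coordinates of the starting point and
the end-point. -/
theorem coord_endpt_blockWord {d n : ℕ} (L : ℕ) (c : ℕ → ℕ → ℕ) (hn : n ≤ d)
    (v : Fin d → ℤ) :
    (∀ t, n < t → coord (endpt (blockWord d L c n) v) t = coord v t) ∧
    ∀ t < n, coord (endpt (blockWord d L c n) v) (t + 1) =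
      coord v (t + 1) + L * coord (endpt (blockWord d L c n) v) t +
        ∑ j ∈ Finset.range (t + 1), c t j * coord (endpt (blockWord d L c n) v) j := by
  induction n with
  | zero => exact ⟨fun t _ => rfl, fun t ht => absurd ht (Nat.not_lt_zero t)⟩
  | succ n ih =>
    obtain ⟨h1, h2⟩ := ih (by omega)
    rw [coord_endpt_blockWord_succ L c (by omega)]
    refine ⟨fun t ht => ?_, fun t ht => ?_⟩
    · rw [Function.update_of_ne (by omega), h1 t (by omega)]
    · have hne : t ≠ n + 1 := by omega
      have hs : ∑ j ∈ Finset.range (t + 1), (c t j : ℤ) *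
          Function.update (coord (endpt (blockWord d L c n) v)) (n + 1)
            (coord (endpt (blockWord d L c n) v) (n + 1) +
              L * coord (endpt (blockWord d L c n) v) n +
              ∑ j ∈ Finset.range (n + 1), c n j * coord (endpt (blockWord d L c n) v) j) j =
          ∑ j ∈ Finset.range (t + 1), c t j * coord (endpt (blockWord d L c n) v) j := by
        refine Finset.sum_congr rfl fun j hj => ?_
        rw [Function.update_of_ne (by have := Finset.mem_range.1 hj; omega)]
      rw [hs, Function.update_of_ne hne]
      rcases Nat.lt_succ_iff_lt_or_eq.1 ht with h | rfl
      · rw [Function.update_of_ne (by omega), h2 t h]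
      · rw [Function.update_self, h1 (t + 1) (by omega)]

theorem endpt_blockWord_nonneg {d n : ℕ} (L : ℕ) (c : ℕ → ℕ → ℕ) (hn : n ≤ d) {v : Fin d → ℤ}
    (hv : 0 ≤ v) : 0 ≤ endpt (blockWord d L c n) v := by
  have key : ∀ t, 0 ≤ coord (endpt (blockWord d L c n) v) t := by
    obtain ⟨h1, h2⟩ := coord_endpt_blockWord L c hn v
    intro t
    induction t using Nat.strong_induction_on with
    | _ t ih =>
      rcases t with _ | t
      · simp
      · by_cases ht : t < n
        · rw [h2 t ht]
          have h3 := coord_nonneg hv (t + 1)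
          have h4 : 0 ≤ ∑ j ∈ Finset.range (t + 1),
              (c t j : ℤ) * coord (endpt (blockWord d L c n) v) j :=
            Finset.sum_nonneg fun j hj =>
              mul_nonneg (Int.natCast_nonneg _) (ih j (Finset.mem_range.1 hj))
          have h5 : 0 ≤ (L : ℤ) * coord (endpt (blockWord d L c n) v) t :=
            mul_nonneg (Int.natCast_nonneg _) (ih t (Nat.lt_succ_self t))
          omega
        · rw [h1 (t + 1) (by omega)]
          exact coord_nonneg hv _
  intro i
  have := key (i + 1)
  rwa [coord_succ] at this

/-! ### Reading the digits off the row of the end-point -/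

/-- In a positional system with rapidly growing weights, a number is less than the next weight. -/
theorem digits_lt {L : ℕ} {x : ℕ → ℤ} (h0 : 0 < x 0) {n : ℕ}
    (hx : ∀ t < n, 0 ≤ x t ∧ L * x t ≤ x (t + 1)) {c : ℕ → ℕ} (hc : ∀ t < n, c t < L) :
    ∑ j ∈ Finset.range n, (c j : ℤ) * x j < x n := by
  induction n with
  | zero => simpa using h0
  | succ n ih =>
    have h := ih (fun t ht => hx t (by omega)) (fun t ht => hc t (by omega))
    obtain ⟨h1, h2⟩ := hx n (by omega)
    have h3 : (c n : ℤ) + 1 ≤ L := by exact_mod_cast hc n (by omega)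
    rw [Finset.sum_range_succ]
    nlinarith [mul_le_mul_of_nonneg_right h3 h1]

/-- In a positional system with rapidly growing weights, the digits are determined. -/
theorem digits_unique {L : ℕ} {x : ℕ → ℤ} (h0 : 0 < x 0) {n : ℕ}
    (hx : ∀ t < n, 0 ≤ x t ∧ L * x t ≤ x (t + 1)) {c c' : ℕ → ℕ}
    (hc : ∀ t ≤ n, c t < L) (hc' : ∀ t ≤ n, c' t < L)
    (h : ∑ j ∈ Finset.range (n + 1), (c j : ℤ) * x j =
      ∑ j ∈ Finset.range (n + 1), (c' j : ℤ) * x j) : ∀ t ≤ n, c t = c' t := by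
  -- A larger top digit of `e` cannot be compensated by the lower digits of `e'`, whose total is
  -- less than `x n`. Exchanging the roles gives equality.
  have aux : ∀ {e e' : ℕ → ℕ} {n : ℕ}, (∀ t < n, 0 ≤ x t ∧ L * x t ≤ x (t + 1)) →
      (∀ t ≤ n, e t < L) → (∀ t ≤ n, e' t < L) →
      ∑ j ∈ Finset.range (n + 1), (e j : ℤ) * x j =
        ∑ j ∈ Finset.range (n + 1), (e' j : ℤ) * x j → e n ≤ e' n := by
    intro e e' n hx he he' h
    by_contra! hlt
    have h1 := digits_lt h0 hx (c := e') fun t ht => he' t ht.le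
    have h2 : 0 ≤ ∑ j ∈ Finset.range n, (e j : ℤ) * x j := Finset.sum_nonneg fun j hj =>
      mul_nonneg (Int.natCast_nonneg _) (hx j (Finset.mem_range.1 hj)).1
    have h3 : 0 ≤ ∑ j ∈ Finset.range n, (e' j : ℤ) * x j := Finset.sum_nonneg fun j hj =>
      mul_nonneg (Int.natCast_nonneg _) (hx j (Finset.mem_range.1 hj)).1
    rw [Finset.sum_range_succ, Finset.sum_range_succ] at h
    have h4 : (e' n : ℤ) + 1 ≤ e n := by exact_mod_cast hlt
    nlinarith [mul_le_mul_of_nonneg_right h4 (h3.trans h1.le)]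
  induction n with
  | zero =>
    intro t ht
    obtain rfl : t = 0 := by omega
    exact le_antisymm (aux hx hc hc' h) (aux hx hc' hc h.symm)
  | succ n ih =>
    have hn : c (n + 1) = c' (n + 1) :=
      le_antisymm (aux hx hc hc' h) (aux hx hc' hc h.symm)
    rw [Finset.sum_range_succ, Finset.sum_range_succ _ (n + 1), hn, add_left_inj] at h
    intro t ht
    rcases Nat.le_succ_iff.1 ht with h' | rfl
    · exact ih (fun t ht => hx t (by omega)) (fun t ht => hc t (by omega))
        (fun t ht => hc' t (by omega)) h t h'
    · exact hn

/-- Two points agree in all coordinates but the last. -/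
def SameRow {d : ℕ} (v w : Fin d → ℤ) : Prop := ∀ i : Fin d, (i : ℕ) + 1 < d → v i = w i

/-- By triangularity, no coordinate but the last depends on the last one. -/
theorem sameRow_act {d : ℕ} (g : N d) {v w : Fin d → ℤ} (h : SameRow v w) :
    SameRow (act g v) (act g w) := by
  intro i hi
  rw [act_apply, act_apply]
  congr 1
  refine Finset.sum_congr rfl fun j _ => ?_
  rcases lt_or_ge i j with hij | hij
  · rw [g.2.2 i.succ j.succ (Fin.succ_lt_succ_iff.2 hij), zero_mul, zero_mul]
  · rw [h j (by have : (j : ℕ) ≤ i := hij; omega)]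

theorem sameRow_act_iff {d : ℕ} (g : N d) {v w : Fin d → ℤ} :
    SameRow (act g v) (act g w) ↔ SameRow v w := by
  refine ⟨fun h => ?_, sameRow_act g⟩
  have := sameRow_act g⁻¹ h
  rwa [← act_mul, ← act_mul, inv_mul_cancel, act_one, act_one] at this

theorem coord_eq_of_sameRow {m : ℕ} {v w : Fin (m + 1) → ℤ} (h : SameRow v w) {t : ℕ}
    (ht : t ≤ m) : coord v t = coord w t := by
  rcases t with _ | t
  · simp
  · have h1 := coord_succ v ⟨t, by omega⟩
    have h2 := coord_succ w ⟨t, by omega⟩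
    have := h ⟨t, by omega⟩ (by simpa using ht)
    simp only at h1 h2
    rw [h1, h2, this]

/-- The digits of a block word are determined by the row of its end-point. -/
theorem blockWord_injective {m L : ℕ} {c c' : ℕ → ℕ → ℕ} (hc : ∀ i j, c i j < L)
    (hc' : ∀ i j, c' i j < L) {v : Fin (m + 1) → ℤ} (hv : 0 ≤ v)
    (h : SameRow (endpt (blockWord (m + 1) L c m) v) (endpt (blockWord (m + 1) L c' m) v)) :
    ∀ i < m, ∀ j ≤ i, c i j = c' i j := by
  set y := coord (endpt (blockWord (m + 1) L c m) v) with hy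
  set y' := coord (endpt (blockWord (m + 1) L c' m) v) with hy'
  have hyy : ∀ t ≤ m, y t = y' t := fun t ht => coord_eq_of_sameRow h ht
  have h2 := (coord_endpt_blockWord L c (Nat.le_succ m) v).2
  have h2' := (coord_endpt_blockWord L c' (Nat.le_succ m) v).2
  rw [← hy] at h2
  rw [← hy'] at h2'
  have hy0 : ∀ t, 0 ≤ y t := fun t =>
    coord_nonneg (endpt_blockWord_nonneg L c (Nat.le_succ m) hv) t
  intro i hi
  -- The weights are the coordinates of the common end row. They grow by the factor `L` because of
  -- the first `L` letters at each level, and both digit sums equal `y (i + 1) - coord v (i + 1) - L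
  -- * y i`.
  refine digits_unique (x := y) (L := L) ?_ (fun t ht => ⟨hy0 t, ?_⟩) (fun t _ => hc i t)
    (fun t _ => hc' i t) ?_
  · simp [hy]
  · rw [h2 t (by omega)]
    have h3 := coord_nonneg hv (t + 1)
    have h4 : 0 ≤ ∑ j ∈ Finset.range (t + 1), (c t j : ℤ) * y j :=
      Finset.sum_nonneg fun j _ => mul_nonneg (Int.natCast_nonneg _) (hy0 j)
    omega
  · have e1 := h2 i hi
    have e2 := h2' i hi
    have e3 : ∑ j ∈ Finset.range (i + 1), (c' i j : ℤ) * y' j =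
        ∑ j ∈ Finset.range (i + 1), (c' i j : ℤ) * y j := by
      refine Finset.sum_congr rfl fun j hj => ?_
      rw [hyy j (by have := Finset.mem_range.1 hj; omega)]
    rw [hyy (i + 1) (by omega), e2, ← hyy i (by omega), e3] at e1
    omega

/-! ### The cost of a path -/

/-- The sum of `lam ^ β` along the path that starts at `v` and follows the letters of a word
(the end-point is not counted). -/
noncomputable def cost {d : ℕ} (lam : (Fin d → ℤ) → ℝ) (β : ℝ) :
    List (N d) → (Fin d → ℤ) → ℝ
  | [], _ => 0
  | g :: w, v => lam v ^ β + cost lam β w (act g v)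

/-- A word in the elementary matrices with a coefficient `1` below the diagonal. -/
def IsGenWord {d : ℕ} (w : List (N d)) : Prop :=
  ∀ g ∈ w, ∃ i j, j ≤ i ∧ i < d ∧ g = gen d i j 1

theorem IsGenWord.append {d : ℕ} {w w' : List (N d)} (h : IsGenWord w) (h' : IsGenWord w') :
    IsGenWord (w ++ w') := fun g hg => (List.mem_append.1 hg).elim (h g) (h' g)

theorem isGenWord_digitWord {d i : ℕ} (hi : i < d) (c : ℕ → ℕ) {n : ℕ} (hn : n ≤ i + 1) :
    IsGenWord (digitWord d i c n) := by
  induction n with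
  | zero => intro g hg; simp [digitWord] at hg
  | succ n ih =>
    refine (ih (by omega)).append fun g hg => ?_
    exact ⟨i, n, by omega, hi, List.eq_of_mem_replicate hg⟩

theorem isGenWord_blockWord {d L : ℕ} (c : ℕ → ℕ → ℕ) {n : ℕ} (hn : n ≤ d) :
    IsGenWord (blockWord d L c n) := by
  induction n with
  | zero => intro g hg; simp [blockWord] at hg
  | succ n ih =>
    refine (ih (by omega)).append (IsGenWord.append (fun g hg => ?_)
      (isGenWord_digitWord (by omega) _ le_rfl))
    exact ⟨n, n, le_rfl, by omega, List.eq_of_mem_replicate hg⟩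

theorem length_digitWord_le {d i L : ℕ} {c : ℕ → ℕ} (hc : ∀ j, c j < L) (n : ℕ) :
    (digitWord d i c n).length ≤ n * L := by
  induction n with
  | zero => simp [digitWord]
  | succ n ih =>
    rw [digitWord, List.length_append, List.length_replicate, Nat.succ_mul]
    exact add_le_add ih (hc n).le

theorem length_blockWord_le {d L : ℕ} {c : ℕ → ℕ → ℕ} (hc : ∀ i j, c i j < L) (n : ℕ) :
    (blockWord d L c n).length ≤ n * (n + 1) * L := by
  induction n with
  | zero => simp [blockWord]
  | succ n ih =>
    rw [blockWord, List.length_append, List.length_append, List.length_replicate]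
    have := length_digitWord_le (d := d) (i := n) (hc n) (n + 1)
    nlinarith [Nat.zero_le (n * L), Nat.zero_le L]

theorem le_length_blockWord {d L : ℕ} (c : ℕ → ℕ → ℕ) {n : ℕ} (hn : 1 ≤ n) :
    L ≤ (blockWord d L c n).length := by
  obtain ⟨n, rfl⟩ := Nat.exists_eq_succ_of_ne_zero (by omega : n ≠ 0)
  rw [Nat.succ_eq_add_one, blockWord, List.length_append, List.length_append,
    List.length_replicate]
  omega

section

variable {d : ℕ} {lam : (Fin d → ℤ) → ℝ} {β : ℝ}

@[simp] theorem cost_nil (v : Fin d → ℤ) : cost lam β [] v = 0 := rfl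

@[simp] theorem cost_cons (g : N d) (w : List (N d)) (v : Fin d → ℤ) :
    cost lam β (g :: w) v = lam v ^ β + cost lam β w (act g v) := rfl

theorem cost_append (w w' : List (N d)) (v : Fin d → ℤ) :
    cost lam β (w ++ w') v = cost lam β w v + cost lam β w' (endpt w v) := by
  induction w generalizing v with
  | nil => simp
  | cons g w ih => simp [ih, add_assoc]

theorem cost_nonneg (h0 : ∀ v, 0 ≤ lam v) (w : List (N d)) (v : Fin d → ℤ) :
    0 ≤ cost lam β w v := by
  induction w generalizing v with
  | nil => simp
  | cons g w ih => exact add_nonneg (Real.rpow_nonneg (h0 v) β) (ih _)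

/-- A long path of small cost visits a point where `lam` is small. -/
theorem exists_prefix (w : List (N d)) (hw : w ≠ []) (v : Fin d → ℤ) :
    ∃ w₁ w₂, w = w₁ ++ w₂ ∧ w.length * lam (endpt w₁ v) ^ β ≤ cost lam β w v := by
  by_contra! hcon
  -- The threshold `t`, later the mean cost per letter, stays fixed while the word shrinks in the
  -- induction.
  suffices h : ∀ (t : ℝ) (w : List (N d)) (v : Fin d → ℤ), w ≠ [] →
      (∀ w₁ w₂, w = w₁ ++ w₂ → t < lam (endpt w₁ v) ^ β) → w.length * t < cost lam β w v by
    have hpos : (0 : ℝ) < w.length := by exact_mod_cast List.length_pos_iff.2 hw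
    have := h (cost lam β w v / w.length) w v hw fun w₁ w₂ h12 => by
      rw [div_lt_iff₀ hpos, mul_comm]
      exact hcon w₁ w₂ h12
    rw [mul_div_cancel₀ _ hpos.ne'] at this
    exact lt_irrefl _ this
  intro t w
  induction w with
  | nil => intro v h; exact absurd rfl h
  | cons g w ih =>
    intro v _ h
    have h1 := h [] (g :: w) rfl
    rw [endpt_nil] at h1
    rw [List.length_cons, cost_cons]
    push_cast
    rcases eq_or_ne w [] with rfl | hw
    · simpa using h1
    · have := ih (act g v) hw fun w₁ w₂ h12 => by
        simpa using h (g :: w₁) w₂ (by rw [h12, List.cons_append])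
      linarith

/-! ### Averages over points of different rows -/

/-- The sums of `lam` over points of different rows are at most `1`. -/
def RowSummable (lam : (Fin d → ℤ) → ℝ) : Prop :=
  ∀ (ι : Type) [Fintype ι] (x : ι → Fin d → ℤ),
    Pairwise (fun i j => ¬ SameRow (x i) (x j)) → ∑ i, lam (x i) ≤ 1

/-- Hölder's inequality with exponent `1 / β`; equal values are the extreme case. -/
theorem sum_rpow_le {ι : Type} [Fintype ι] {f : ι → ℝ} (hf : ∀ i, 0 ≤ f i) (h1 : ∑ i, f i ≤ 1)
    (hβ0 : 0 < β) (hβ1 : β ≤ 1) : ∑ i, f i ^ β ≤ (Fintype.card ι : ℝ) ^ (1 - β) := by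
  have hp : 1 ≤ 1 / β := by rw [le_div_iff₀ hβ0]; linarith
  have h := Real.rpow_sum_le_const_mul_sum_rpow_of_nonneg Finset.univ hp
    (f := fun i => f i ^ β) fun i _ => Real.rpow_nonneg (hf i) β
  have h2 : ∑ i, (f i ^ β) ^ (1 / β) = ∑ i, f i := by
    refine Finset.sum_congr rfl fun i _ => ?_
    rw [← Real.rpow_mul (hf i), mul_one_div_cancel hβ0.ne', Real.rpow_one]
  rw [h2, Finset.card_univ] at h
  have hs : 0 ≤ ∑ i, f i ^ β := Finset.sum_nonneg fun i _ => Real.rpow_nonneg (hf i) β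
  have hc : (0 : ℝ) ≤ Fintype.card ι := Nat.cast_nonneg _
  have h3 : (∑ i, f i ^ β) ^ (1 / β) ≤ (Fintype.card ι : ℝ) ^ (1 / β - 1) :=
    h.trans (mul_le_of_le_one_right (Real.rpow_nonneg hc _) h1)
  have h4 := Real.rpow_le_rpow (Real.rpow_nonneg hs _) h3 hβ0.le
  rw [← Real.rpow_mul hs, ← Real.rpow_mul hc, one_div_mul_cancel hβ0.ne', Real.rpow_one,
    sub_mul, one_div_mul_cancel hβ0.ne', one_mul] at h4
  exact h4

/-- Group elements keep distinct rows distinct, so `sum_rpow_le` applies after each letter. -/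
theorem sum_cost_le (h0 : ∀ v, 0 ≤ lam v) (hlam : RowSummable lam) (hβ0 : 0 < β) (hβ1 : β ≤ 1)
    {ι : Type} [Fintype ι] (w : List (N d)) (x : ι → Fin d → ℤ)
    (hx : Pairwise fun i j => ¬ SameRow (x i) (x j)) :
    ∑ i, cost lam β w (x i) ≤ w.length * (Fintype.card ι : ℝ) ^ (1 - β) := by
  induction w generalizing x with
  | nil => simp
  | cons g w ih =>
    have h1 := ih (fun i => act g (x i)) fun i j hij h =>
      hx hij ((sameRow_act_iff g).1 h)
    have h2 := sum_rpow_le (fun i => h0 (x i)) (hlam ι x hx) hβ0 hβ1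
    simp only [cost_cons, Finset.sum_add_distrib, List.length_cons]
    push_cast
    linarith

end

/-! ### Long paths of bounded cost -/

/-- The digits that are used in a block. -/
abbrev Digits (m L : ℕ) : Type := (i : Fin m) → Fin (i + 1) → Fin L

/-- There is one digit for each pair `j ≤ i < m`; with `d = m + 1`, this is the source of `d (d - 1)
/ 2` in the critical exponent. -/
theorem card_digits (m L : ℕ) : Fintype.card (Digits m L) = L ^ ((m + 1) * m / 2) := by
  rw [Fintype.card_pi]
  simp only [Fintype.card_pi, Fintype.card_fin, Finset.prod_const, Finset.card_univ]
  rw [Finset.prod_pow_eq_pow_sum, Fin.sum_univ_eq_sum_range (fun i => i + 1)]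
  congr 1
  have := Finset.sum_range_succ' (fun i => i) m
  rw [add_zero] at this
  rw [← this, Finset.sum_range_id, Nat.add_sub_cancel]

/-- The digits, continued by zeros. -/
def Digits.extend {m L : ℕ} (c : Digits m L) (i j : ℕ) : ℕ :=
  if h : i < m ∧ j < i + 1 then c ⟨i, h.1⟩ ⟨j, h.2⟩ else 0

theorem Digits.extend_lt {m L : ℕ} (hL : 0 < L) (c : Digits m L) (i j : ℕ) : c.extend i j < L := by
  unfold Digits.extend
  split_ifs
  exacts [Fin.is_lt _, hL]

theorem Digits.ext_extend {m L : ℕ} {c c' : Digits m L}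
    (h : ∀ i < m, ∀ j ≤ i, c.extend i j = c'.extend i j) : c = c' := by
  funext i j
  have := h i i.2 j (Nat.lt_succ_iff.1 j.2)
  rw [Digits.extend, Digits.extend, dif_pos ⟨i.2, j.2⟩, dif_pos ⟨i.2, j.2⟩] at this
  exact Fin.ext this

/-- The block word with given digits. -/
def Digits.word {m L : ℕ} (c : Digits m L) : List (N (m + 1)) := blockWord (m + 1) L c.extend m

theorem Digits.not_sameRow {m L : ℕ} (hL : 0 < L) {v : Fin (m + 1) → ℤ} (hv : 0 ≤ v) :
    Pairwise fun c c' : Digits m L => ¬ SameRow (endpt c.word v) (endpt c'.word v) :=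
  fun c c' hne h => hne <| Digits.ext_extend <|
    blockWord_injective (c.extend_lt hL) (c'.extend_lt hL) hv h

section

variable {m : ℕ} {lam : (Fin (m + 1) → ℤ) → ℝ} {β : ℝ}

/-- The sum over the starting points of the mean cost of a block. -/
theorem sum_sum_cost_le (h0 : ∀ v, 0 ≤ lam v) (hlam : RowSummable lam) (hβ0 : 0 < β) (hβ1 : β ≤ 1)
    {L L' : ℕ} (hL : 0 < L) (hL' : 0 < L') {v : Fin (m + 1) → ℤ} (hv : 0 ≤ v) :
    ∑ c : Digits m L, ∑ c' : Digits m L', cost lam β c'.word (endpt c.word v) ≤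
      Fintype.card (Digits m L') *
        ((m * (m + 1) * L' : ℕ) * (Fintype.card (Digits m L) : ℝ) ^ (1 - β)) := by
  -- For a fixed second block `c'`, the starting points `endpt c.word v` lie in distinct rows.
  rw [Finset.sum_comm, ← nsmul_eq_mul, ← Finset.card_univ]
  refine Finset.sum_le_card_nsmul _ _ _ fun c' _ => ?_
  refine (sum_cost_le h0 hlam hβ0 hβ1 c'.word _ (Digits.not_sameRow hL hv)).trans ?_
  refine mul_le_mul_of_nonneg_right ?_ (Real.rpow_nonneg (Nat.cast_nonneg _) _)
  exact_mod_cast length_blockWord_le (c'.extend_lt hL') m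

/-- Blocks of scales `2 ^ k`, `2 ^ (k + 1)`, … are concatenated, each chosen no worse than average.
By `hA`, the mean cost of a block of scale `2 ^ (k + 1)` after one of scale `2 ^ k` is at most `A *
r ^ k`, so the cost is at most the mean cost of the first block plus the sum of a geometric series.
-/
theorem exists_long_word_aux (hm : 1 ≤ m) (h0 : ∀ v, 0 ≤ lam v) (hlam : RowSummable lam)
    (hβ0 : 0 < β) (hβ1 : β ≤ 1) {A r : ℝ} (hr0 : 0 < r) (hr1 : r < 1) (hA0 : 0 ≤ A)
    (hA : ∀ k : ℕ, (m * (m + 1) * 2 ^ (k + 1) : ℕ) *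
      (Fintype.card (Digits m (2 ^ k)) : ℝ) ^ (1 - β) ≤
        Fintype.card (Digits m (2 ^ k)) * (A * r ^ k)) (n : ℕ) :
    ∀ (k : ℕ) (v : Fin (m + 1) → ℤ), 0 ≤ v → ∃ w : List (N (m + 1)), IsGenWord w ∧
      n ≤ w.length ∧ Fintype.card (Digits m (2 ^ k)) * cost lam β w v ≤
        ∑ c : Digits m (2 ^ k), cost lam β c.word v +
          Fintype.card (Digits m (2 ^ k)) * (A * r ^ k / (1 - r)) := by
  have hr : 0 < 1 - r := by linarith
  induction n with
  | zero =>
    intro k v _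
    refine ⟨[], fun g hg => absurd hg List.not_mem_nil, le_rfl, ?_⟩
    rw [cost_nil, mul_zero]
    refine add_nonneg (Finset.sum_nonneg fun c _ => cost_nonneg h0 _ _) ?_
    positivity
  | succ n ih =>
    intro k v hv
    have hpos : ∀ k : ℕ, 0 < 2 ^ k := fun k => by positivity
    have hcard : ∀ k : ℕ, (0 : ℝ) < Fintype.card (Digits m (2 ^ k)) := fun k => by
      rw [card_digits]
      positivity
    -- Every block `c` gets a continuation at the next scale; only afterwards is `c` chosen, by
    -- averaging the total cost.
    choose w hw hlen hcost using fun c : Digits m (2 ^ k) =>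
      ih (k + 1) (endpt c.word v) (endpt_blockWord_nonneg _ _ (Nat.le_succ m) hv)
    set K := (Fintype.card (Digits m (2 ^ k)) : ℝ) with hK
    set K' := (Fintype.card (Digits m (2 ^ (k + 1))) : ℝ) with hK'
    have hsum : K' * ∑ c, cost lam β (w c) (endpt c.word v) ≤
        K' * (K * (A * r ^ k) + K * (A * r ^ (k + 1) / (1 - r))) := by
      rw [Finset.mul_sum]
      refine (Finset.sum_le_sum fun c _ => hcost c).trans ?_
      rw [Finset.sum_add_distrib, Finset.sum_const, Finset.card_univ, nsmul_eq_mul]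
      have h1 := sum_sum_cost_le h0 hlam hβ0 hβ1 (hpos k) (hpos (k + 1)) hv
      have h2 := mul_le_mul_of_nonneg_left (hA k) (hcard (k + 1)).le
      rw [← hK, ← hK'] at *
      linarith
    have hsum' := le_of_mul_le_mul_left hsum (hcard (k + 1))
    have hgeo : K * (A * r ^ k) + K * (A * r ^ (k + 1) / (1 - r)) =
        K * (A * r ^ k / (1 - r)) := by
      field_simp
      ring
    rw [hgeo] at hsum'
    have htot : ∑ c : Digits m (2 ^ k), cost lam β (c.word ++ w c) v ≤
        ∑ _c : Digits m (2 ^ k), (∑ c : Digits m (2 ^ k), cost lam β c.word v +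
          K * (A * r ^ k / (1 - r))) / K := by
      simp only [cost_append, Finset.sum_add_distrib, Finset.sum_const, Finset.card_univ,
        nsmul_eq_mul]
      rw [← hK, mul_div_cancel₀ _ (hcard k).ne']
      linarith
    have hne : (Finset.univ : Finset (Digits m (2 ^ k))).Nonempty := by
      rw [← Finset.card_pos, Finset.card_univ]
      exact_mod_cast hcard k
    obtain ⟨c, -, hc⟩ := Finset.exists_le_of_sum_le hne htot
    refine ⟨c.word ++ w c, IsGenWord.append (isGenWord_blockWord _ (Nat.le_succ m)) (hw c), ?_, ?_⟩
    · have h1 := le_length_blockWord (d := m + 1) (L := 2 ^ k) c.extend hm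
      have h2 := hlen c
      have h3 := hpos k
      rw [List.length_append]
      change 2 ^ k ≤ c.word.length at h1
      omega
    · rwa [le_div_iff₀ (hcard k), mul_comm] at hc

/-- There are arbitrarily long paths from the origin with a bounded cost. -/
theorem exists_long_word (hm : 1 ≤ m) (h0 : ∀ v, 0 ≤ lam v) (hlam : RowSummable lam)
    (hβ0 : 0 < β) (hβ1 : β ≤ 1) (hβ : 1 < β * (((m + 1) * m / 2 : ℕ) : ℝ)) :
    ∃ S : ℝ, ∀ n : ℕ, ∃ w : List (N (m + 1)), IsGenWord w ∧ n ≤ w.length ∧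
      cost lam β w 0 ≤ S := by
  set D : ℝ := (((m + 1) * m / 2 : ℕ) : ℝ) with hD
  -- From one scale to the next the block length doubles, while the bound for the mean of `lam ^ β`
  -- is divided by `2 ^ (β * D)`.
  set r : ℝ := 2 ^ (1 - β * D) with hr
  set A : ℝ := 2 * (m * (m + 1) : ℕ) with hA
  have hr0 : 0 < r := Real.rpow_pos_of_pos two_pos _
  have hr1 : r < 1 := Real.rpow_lt_one_of_one_lt_of_neg one_lt_two (by linarith)
  have hA0 : 0 ≤ A := by positivity
  have hbound : ∀ k : ℕ, (m * (m + 1) * 2 ^ (k + 1) : ℕ) *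
      (Fintype.card (Digits m (2 ^ k)) : ℝ) ^ (1 - β) ≤
        Fintype.card (Digits m (2 ^ k)) * (A * r ^ k) := by
    intro k
    have hc : (Fintype.card (Digits m (2 ^ k)) : ℝ) = (2 : ℝ) ^ ((k : ℝ) * D) := by
      rw [card_digits, ← pow_mul, hD, ← Nat.cast_mul, Real.rpow_natCast]
      push_cast
      rfl
    have hrk : r ^ k = (2 : ℝ) ^ ((k : ℝ) * (1 - β * D)) := by
      rw [hr, ← Real.rpow_natCast, ← Real.rpow_mul two_pos.le, mul_comm]
    rw [hc, hrk, ← Real.rpow_mul two_pos.le, hA]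
    have h2k : ((m * (m + 1) * 2 ^ (k + 1) : ℕ) : ℝ) =
        2 * (m * (m + 1) : ℕ) * (2 : ℝ) ^ (k : ℝ) := by
      rw [Real.rpow_natCast]
      push_cast
      ring
    rw [h2k]
    apply le_of_eq
    have e1 : (2 : ℝ) ^ (k : ℝ) * (2 : ℝ) ^ ((k : ℝ) * D * (1 - β)) =
        (2 : ℝ) ^ ((k : ℝ) * D) * (2 : ℝ) ^ ((k : ℝ) * (1 - β * D)) := by
      rw [← Real.rpow_add two_pos, ← Real.rpow_add two_pos]
      congr 1
      ring
    linear_combination 2 * (m * (m + 1) : ℕ) * e1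
  refine ⟨∑ c : Digits m (2 ^ 0), cost lam β c.word 0 + A * r ^ 0 / (1 - r), fun n => ?_⟩
  obtain ⟨w, hw, hlen, hcost⟩ :=
    exists_long_word_aux hm h0 hlam hβ0 hβ1 hr0 hr1 hA0 hbound n 0 0 le_rfl
  refine ⟨w, hw, hlen, ?_⟩
  -- At scale `2 ^ 0` all digits vanish, so there is only one block and the mean is its cost.
  have h1 : (Fintype.card (Digits m (2 ^ 0)) : ℝ) = 1 := by
    rw [card_digits, pow_zero, one_pow, Nat.cast_one]
  rwa [h1, one_mul, one_mul] at hcost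

end

/-! ### The central translations -/

/-- The central element that adds `c` to the last coordinate. -/
def central (m : ℕ) (c : ℤ) : N (m + 1) := gen (m + 1) m 0 c

section

variable {m : ℕ}

theorem act_central (c : ℤ) (v : Fin (m + 1) → ℤ) :
    act (central m c) v = Function.update v (Fin.last m) (v (Fin.last m) + c) := by
  funext i
  rw [← coord_succ (act _ _), central, coord_gen (Nat.zero_le m) (Nat.lt_succ_self m)]
  rcases eq_or_ne i (Fin.last m) with rfl | hi
  · have := coord_succ v (Fin.last m)
    rw [Fin.val_last] at this
    rw [Fin.val_last, Function.update_self, Function.update_self, this, coord_zero, mul_one]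
  · have : (i : ℕ) ≠ m := fun h => hi (Fin.ext h)
    rw [Function.update_of_ne hi, Function.update_of_ne (by omega), coord_succ]

theorem act_central_of_lt (c : ℤ) (v : Fin (m + 1) → ℤ) {i : Fin (m + 1)} (hi : (i : ℕ) < m) :
    act (central m c) v i = v i := by
  rw [act_central, Function.update_of_ne]
  rintro rfl
  exact lt_irrefl _ hi

theorem sameRow_act_central (c : ℤ) (v : Fin (m + 1) → ℤ) : SameRow v (act (central m c) v) :=
  fun i hi => (act_central_of_lt c v (by omega)).symm

theorem act_central_central (c c' : ℤ) (v : Fin (m + 1) → ℤ) :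
    act (central m c) (act (central m c') v) = act (central m (c + c')) v := by
  simp only [act_central, Function.update_self, Function.update_idem]
  congr 1
  ring

theorem exists_act_central_eq {v w : Fin (m + 1) → ℤ} (h : SameRow v w) :
    ∃ c, act (central m c) v = w := by
  refine ⟨w (Fin.last m) - v (Fin.last m), ?_⟩
  rw [act_central, add_sub_cancel]
  funext i
  rcases eq_or_ne i (Fin.last m) with rfl | hi
  · rw [Function.update_self]
  · rw [Function.update_of_ne hi]
    refine h i ?_
    have := Fin.val_lt_last hi
    omega

/-- The last coordinate influences only itself, with coefficient `1`. -/
theorem act_comm_central (g : N (m + 1)) (c : ℤ) (v : Fin (m + 1) → ℤ) :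
    act g (act (central m c) v) = act (central m c) (act g v) := by
  funext i
  have hsum : ∑ j : Fin (m + 1), (g : Matrix.SpecialLinearGroup (Fin (m + 1 + 1)) ℤ) i.succ j.succ *
      act (central m c) v j = ∑ j : Fin (m + 1),
        (g : Matrix.SpecialLinearGroup (Fin (m + 1 + 1)) ℤ) i.succ j.succ * v j +
          (g : Matrix.SpecialLinearGroup (Fin (m + 1 + 1)) ℤ) i.succ (Fin.last m).succ * c := by
    rw [Fin.sum_univ_castSucc, Fin.sum_univ_castSucc, act_central, Function.update_self]
    simp only [Function.update_of_ne (Fin.castSucc_lt_last _).ne]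
    ring
  rw [act_apply, hsum, ← add_assoc, ← act_apply, act_central]
  rcases eq_or_ne i (Fin.last m) with rfl | hi
  · rw [Function.update_self, g.2.1, one_mul]
  · rw [Function.update_of_ne hi, g.2.2 _ _ (Fin.succ_lt_succ_iff.2 (Fin.lt_last_iff_ne_last.2 hi)),
      zero_mul, add_zero]

theorem endpt_act_central (w : List (N (m + 1))) (c : ℤ) (v : Fin (m + 1) → ℤ) :
    endpt w (act (central m c) v) = act (central m c) (endpt w v) := by
  induction w generalizing v with
  | nil => rfl
  | cons g w ih => rw [endpt_cons, endpt_cons, act_comm_central, ih]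

/-! ### Control of distortion -/

variable {rho lam : (Fin (m + 1) → ℤ) → ℝ} {β : ℝ}

/-- Ratios telescope along the path, so the exponents add up to the cost. The generators are
finitely many, and the sum of their constants serves for all of them. -/
theorem exists_word_distortion (hrho : ∀ v, 0 < rho v) (h0 : ∀ v, 0 ≤ lam v)
    (hdist : ∀ g : N (m + 1), ∃ C, 0 ≤ C ∧ ∀ v w, SameRow v w →
      rho (act g w) * rho v ≤ Real.exp (C * lam v ^ β) * (rho w * rho (act g v))) :
    ∃ C, 0 ≤ C ∧ ∀ u : List (N (m + 1)), IsGenWord u → ∀ v w, SameRow v w →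
      rho (endpt u w) * rho v ≤ Real.exp (C * cost lam β u v) * (rho w * rho (endpt u v)) := by
  choose C hC hdist using hdist
  refine ⟨∑ i ∈ Finset.range (m + 1), ∑ j ∈ Finset.range (m + 1), C (gen (m + 1) i j 1),
    Finset.sum_nonneg fun i _ => Finset.sum_nonneg fun j _ => hC _, fun u => ?_⟩
  set C₀ := ∑ i ∈ Finset.range (m + 1), ∑ j ∈ Finset.range (m + 1), C (gen (m + 1) i j 1)
  induction u with
  | nil =>
    intro _ v w _
    simp [mul_comm]
  | cons g u ih =>
    intro hu v w hvw
    have h1 := ih (fun x hx => hu x (List.mem_cons_of_mem g hx)) (act g v) (act g w)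
      (sameRow_act g hvw)
    have hCg : C g ≤ C₀ := by
      obtain ⟨i, j, hji, hi, rfl⟩ := hu g List.mem_cons_self
      refine le_trans ?_ (Finset.single_le_sum (f := fun i => ∑ j ∈ Finset.range (m + 1),
        C (gen (m + 1) i j 1)) (fun i _ => Finset.sum_nonneg fun j _ => hC _)
        (Finset.mem_range.2 hi))
      exact Finset.single_le_sum (f := fun j => C (gen (m + 1) i j 1)) (fun j _ => hC _)
        (Finset.mem_range.2 (by omega))
    have h2 : rho (act g w) * rho v ≤
        Real.exp (C₀ * lam v ^ β) * (rho w * rho (act g v)) := by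
      refine (hdist g v w hvw).trans (mul_le_mul_of_nonneg_right ?_
        (mul_pos (hrho _) (hrho _)).le)
      exact Real.exp_le_exp.2 (mul_le_mul_of_nonneg_right hCg (Real.rpow_nonneg (h0 v) β))
    have h3 := mul_le_mul h1 h2 (mul_pos (hrho _) (hrho _)).le
      (mul_nonneg (Real.exp_pos _).le (mul_pos (hrho _) (hrho _)).le)
    rw [endpt_cons, endpt_cons, cost_cons, mul_add, Real.exp_add]
    refine le_of_mul_le_mul_right ?_ (mul_pos (hrho (act g v)) (hrho (act g w)))
    linarith

/-- There are no families of lengths of intervals with the properties that a `C^(1+β)` action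
would imply. -/
theorem false_of_distortion (hm : 1 ≤ m) (hrho : ∀ v, 0 < rho v) (h0 : ∀ v, 0 ≤ lam v)
    (hlam : RowSummable lam) (hβ0 : 0 < β) (hβ1 : β ≤ 1)
    (hβ : 1 < β * (((m + 1) * m / 2 : ℕ) : ℝ))
    (hsum : ∀ n : ℕ, ∑ k ∈ Finset.range n, rho (act (central m k) 0) ≤ 1)
    (hdist : ∀ g : N (m + 1), ∃ C, 0 ≤ C ∧ ∀ v w, SameRow v w →
      rho (act g w) * rho v ≤ Real.exp (C * lam v ^ β) * (rho w * rho (act g v)))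
    (hcentral : ∀ k : ℤ, ∃ M, 0 ≤ M ∧ ∀ v,
      (1 - M * lam v ^ β) * rho v ≤ rho (act (central m k) v)) : False := by
  obtain ⟨C, hC, hdist⟩ := exists_word_distortion hrho h0 hdist
  obtain ⟨S, hS⟩ := exists_long_word hm h0 hlam hβ0 hβ1 hβ
  set δ := rho 0 / (2 * Real.exp (C * S)) with hδ
  have hδ0 : 0 < δ := div_pos (hrho 0) (mul_pos two_pos (Real.exp_pos _))
  -- The path may depend on `k`, but the bound `S` on its cost, and hence `δ`, does not.
  have key : ∀ k : ℤ, δ ≤ rho (act (central m k) 0) := by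
    intro k
    obtain ⟨M, hM, hMk⟩ := hcentral k
    -- A path with more than `2 * M * S` letters and cost at most `S` visits a point where `M * lam
    -- ^ β ≤ 1 / 2`.
    obtain ⟨n, hn⟩ := exists_nat_gt (2 * M * S)
    obtain ⟨w, hw, hlen, hcost⟩ := hS (n + 1)
    obtain ⟨w₁, w₂, rfl, h12⟩ := exists_prefix (lam := lam) (β := β) w
      (List.ne_nil_of_length_pos (by omega)) 0
    have hcost1 : cost lam β w₁ 0 ≤ S := by
      rw [cost_append] at hcost
      linarith [cost_nonneg (β := β) h0 w₂ (endpt w₁ 0)]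
    set u := endpt w₁ 0 with hu
    have hlen' : (n : ℝ) + 1 ≤ (w₁ ++ w₂).length := by exact_mod_cast hlen
    have hlu := Real.rpow_nonneg (h0 u) β
    have hn0 : (0 : ℝ) ≤ n := Nat.cast_nonneg n
    have hsmall : M * lam u ^ β ≤ 1 / 2 := by
      have h1 : ((n : ℝ) + 1) * lam u ^ β ≤ S :=
        (mul_le_mul_of_nonneg_right hlen' hlu).trans (h12.trans hcost)
      have h2 : ((n : ℝ) + 1) * (M * lam u ^ β) ≤ ((n : ℝ) + 1) * (1 / 2) := by
        have := mul_le_mul_of_nonneg_left h1 hM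
        nlinarith
      exact le_of_mul_le_mul_left h2 (by linarith)
    have h1 : 1 / 2 * rho u ≤ rho (act (central m k) u) :=
      (mul_le_mul_of_nonneg_right (by linarith) (hrho u).le).trans (hMk u)
    -- As central elements commute with the action, `w₁` carries `0` and its translate to `u` and
    -- its translate.
    have h2 := hdist w₁ (fun g hg => hw g (List.mem_append_left _ hg)) 0 _
      (sameRow_act_central k 0)
    rw [endpt_act_central, ← hu] at h2
    have h3 : Real.exp (C * cost lam β w₁ 0) ≤ Real.exp (C * S) :=
      Real.exp_le_exp.2 (mul_le_mul_of_nonneg_left hcost1 hC)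
    have h4 : 1 / 2 * rho u * rho 0 ≤
        Real.exp (C * S) * (rho (act (central m k) 0) * rho u) :=
      (mul_le_mul_of_nonneg_right h1 (hrho 0).le).trans
        (h2.trans (mul_le_mul_of_nonneg_right h3 (mul_pos (hrho _) (hrho _)).le))
    rw [hδ, div_le_iff₀ (mul_pos two_pos (Real.exp_pos _))]
    refine le_of_mul_le_mul_right ?_ (hrho u)
    linarith
  obtain ⟨n, hn⟩ := exists_nat_gt (1 / δ)
  rw [div_lt_iff₀ hδ0] at hn
  have := (Finset.card_nsmul_le_sum (Finset.range n) _ δ fun k _ => key k).trans (hsum n)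
  rw [Finset.card_range, nsmul_eq_mul] at this
  linarith

end

/-! ### Estimates for diffeomorphisms of the interval -/

/-- The mean value theorem. -/
theorem exists_deriv_eq {f : I ≃ₜ I} {f' : I → ℝ}
    (hf : ∀ x : I, HasDerivWithinAt (Set.IccExtend (zero_le_one' ℝ) fun t => (f t : ℝ)) (f' x)
      (Set.Icc 0 1) x) (p q : I) :
    ∃ ξ : I, (ξ : ℝ) ∈ Set.uIcc (p : ℝ) q ∧ |(f p : ℝ) - f q| = |f' ξ| * |(p : ℝ) - q| := by
  wlog hpq : p < q generalizing p q
  · rcases (not_lt.1 hpq).eq_or_lt with rfl | h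
    · exact ⟨q, Set.left_mem_uIcc, by simp⟩
    · obtain ⟨ξ, h1, h2⟩ := this q p h
      exact ⟨ξ, Set.uIcc_comm (q : ℝ) p ▸ h1, by rw [abs_sub_comm, h2, abs_sub_comm (q : ℝ)]⟩
  have hpq' : (p : ℝ) < q := hpq
  set F : ℝ → ℝ := Set.IccExtend (zero_le_one' ℝ) fun t => (f t : ℝ) with hF
  have hsub : Set.Icc (p : ℝ) q ⊆ Set.Icc 0 1 := Set.Icc_subset_Icc p.2.1 q.2.2
  have hcont : ContinuousOn F (Set.Icc p q) := fun x hx =>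
    ((hf ⟨x, hsub hx⟩).continuousWithinAt).mono hsub
  obtain ⟨ξ, hξ, h⟩ := exists_hasDerivAt_eq_slope F
    (Set.IccExtend (zero_le_one' ℝ) f') hpq' hcont fun x hx => by
      have hx' := hsub (Set.Ioo_subset_Icc_self hx)
      rw [Set.IccExtend_of_mem _ _ hx']
      exact (hf ⟨x, hx'⟩).hasDerivAt (Icc_mem_nhds (p.2.1.trans_lt hx.1) (hx.2.trans_le q.2.2))
  have hξ' := hsub (Set.Ioo_subset_Icc_self hξ)
  rw [Set.IccExtend_of_mem _ _ hξ', hF, Set.IccExtend_val, Set.IccExtend_val,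
    eq_div_iff (sub_pos.2 hpq').ne'] at h
  refine ⟨⟨ξ, hξ'⟩, Set.Icc_subset_uIcc (Set.Ioo_subset_Icc_self hξ), ?_⟩
  rw [abs_sub_comm, ← h, abs_mul, abs_sub_comm (q : ℝ)]

/-- Distances in `[0,1]` are at most `1`, so the Hölder exponent can be lowered; `sum_rpow_le` needs
one that is at most `1`. The lower bound `μ` comes from compactness. -/
theorem IsHolderDiffeo.mono {α β : ℝ} (hβ : 0 < β) (h : β ≤ α) {f : I ≃ₜ I}
    (hf : IsHolderDiffeo α f) : ∃ f' : I → ℝ,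
      (∀ x : I, HasDerivWithinAt (Set.IccExtend (zero_le_one' ℝ) fun t => (f t : ℝ)) (f' x)
        (Set.Icc 0 1) x) ∧
      (∃ μ, 0 < μ ∧ ∀ x, μ ≤ |f' x|) ∧
      ∃ M, 0 ≤ M ∧ ∀ x y : I, |f' x - f' y| ≤ M * |(x : ℝ) - (y : ℝ)| ^ β := by
  obtain ⟨f', h1, h2, h3, M, h4⟩ := hf
  refine ⟨f', h1, ?_, |M|, abs_nonneg M, fun x y => ?_⟩
  · obtain ⟨x, -, hx⟩ := isCompact_univ.exists_isMinOn Set.univ_nonempty h2.abs.continuousOn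
    exact ⟨|f' x|, abs_pos.2 (h3 x), fun y => hx (Set.mem_univ y)⟩
  · have hxy : |(x : ℝ) - y| ≤ 1 := by
      rw [abs_le]
      constructor <;> linarith [x.2.1, x.2.2, y.2.1, y.2.2]
    refine (h4 x y).trans (mul_le_mul (le_abs_self M) ?_
      (Real.rpow_nonneg (abs_nonneg _) _) (abs_nonneg M))
    exact Real.rpow_le_rpow_of_exponent_ge' (abs_nonneg _) hxy hβ.le h

/-- The distortion of a `C^(1+β)`-diffeomorphism on two nearby intervals. -/
theorem IsHolderDiffeo.exists_distortion {α β : ℝ} (hβ : 0 < β) (h : β ≤ α) {f : I ≃ₜ I}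
    (hf : IsHolderDiffeo α f) : ∃ C, 0 ≤ C ∧ ∀ (p q p' q' : I) (t : ℝ),
      (∀ ξ ∈ Set.uIcc (p : ℝ) q, ∀ ξ' ∈ Set.uIcc (p' : ℝ) q', |ξ' - ξ| ≤ t) →
      |(f p' : ℝ) - f q'| * |(p : ℝ) - q| ≤
        Real.exp (C * t ^ β) * (|(p' : ℝ) - q'| * |(f p : ℝ) - f q|) := by
  obtain ⟨f', h1, ⟨μ, hμ, h2⟩, M, hM, h3⟩ := hf.mono hβ h
  refine ⟨M / μ, div_nonneg hM hμ.le, fun p q p' q' t ht => ?_⟩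
  obtain ⟨ξ, hξ, e⟩ := exists_deriv_eq h1 p q
  obtain ⟨ξ', hξ', e'⟩ := exists_deriv_eq h1 p' q'
  have h4 : |f' ξ' - f' ξ| ≤ M * t ^ β := (h3 ξ' ξ).trans (mul_le_mul_of_nonneg_left
    (Real.rpow_le_rpow (abs_nonneg _) (ht ξ hξ ξ' hξ') hβ.le) hM)
  have ht0 : 0 ≤ t := (abs_nonneg _).trans (ht ξ hξ ξ' hξ')
  -- The lower bound `μ` turns the additive Hölder estimate into a relative one, and `1 + s ≤ exp s`
  -- does the rest.
  have h5 : |f' ξ'| ≤ |f' ξ| * Real.exp (M / μ * t ^ β) := by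
    have h6 := abs_sub_abs_le_abs_sub (f' ξ') (f' ξ)
    have h7 : M * t ^ β ≤ |f' ξ| * (M / μ * t ^ β) := by
      have h8 : 0 ≤ M / μ * t ^ β := mul_nonneg (div_nonneg hM hμ.le) (Real.rpow_nonneg ht0 β)
      have h9 := mul_le_mul_of_nonneg_right (h2 ξ) h8
      have h10 : μ * (M / μ * t ^ β) = M * t ^ β := by
        field_simp
      linarith
    have h11 := mul_le_mul_of_nonneg_left (Real.add_one_le_exp (M / μ * t ^ β))
      (abs_nonneg (f' ξ))
    linarith
  rw [e, e']
  have := mul_le_mul_of_nonneg_right h5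
    (mul_nonneg (abs_nonneg ((p' : ℝ) - q')) (abs_nonneg ((p : ℝ) - q)))
  linarith

/-- A `C^(1+β)`-diffeomorphism that fixes two nearby points is close to an isometry between
them. -/
theorem IsHolderDiffeo.exists_expansion {α β : ℝ} (hβ : 0 < β) (h : β ≤ α) {f : I ≃ₜ I}
    (hf : IsHolderDiffeo α f) : ∃ M, 0 ≤ M ∧ ∀ p q A B : I, A ≠ B → f A = A → f B = B →
      Set.uIcc (p : ℝ) q ⊆ Set.uIcc (A : ℝ) B →
      (1 - M * |(B : ℝ) - A| ^ β) * |(p : ℝ) - q| ≤ |(f p : ℝ) - f q| := by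
  obtain ⟨f', h1, -, M, hM, h3⟩ := hf.mono hβ h
  refine ⟨M, hM, fun p q A B hAB hA hB hsub => ?_⟩
  obtain ⟨ξ, hξ, e⟩ := exists_deriv_eq h1 p q
  obtain ⟨ξ', hξ', e'⟩ := exists_deriv_eq h1 A B
  rw [hA, hB] at e'
  have hne : |(A : ℝ) - B| ≠ 0 := abs_ne_zero.2 (sub_ne_zero.2 fun h => hAB (Subtype.ext h))
  -- The mean value theorem between two fixed points gives a derivative of modulus `1`.
  have h4 : |f' ξ'| = 1 := mul_right_cancel₀ hne (by rw [one_mul, ← e'])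
  have h5 : |(ξ' : ℝ) - ξ| ≤ |(B : ℝ) - A| :=
    Set.abs_sub_le_of_uIcc_subset_uIcc (Set.uIcc_subset_uIcc (hsub hξ) hξ')
  have h6 : |f' ξ' - f' ξ| ≤ M * |(B : ℝ) - A| ^ β := (h3 ξ' ξ).trans
    (mul_le_mul_of_nonneg_left (Real.rpow_le_rpow (abs_nonneg _) h5 hβ.le) hM)
  have h7 := abs_sub_abs_le_abs_sub (f' ξ') (f' ξ)
  rw [e]
  exact mul_le_mul_of_nonneg_right (by linarith) (abs_nonneg _)

/-- The total length of disjoint subintervals of `[0,1]` is at most `1`. -/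
theorem sum_length_le_one {ι : Type} [Fintype ι] {s t : ι → ℝ} (h0 : ∀ i, 0 ≤ s i)
    (hst : ∀ i, s i ≤ t i) (h1 : ∀ i, t i ≤ 1)
    (hdisj : Pairwise fun i j => t i ≤ s j ∨ t j ≤ s i) : ∑ i, (t i - s i) ≤ 1 := by
  have hd : Pairwise (Function.onFun Disjoint fun i => Set.Ioo (s i) (t i)) := by
    intro i j hij
    refine Set.disjoint_left.2 fun x hx hx' => ?_
    rcases hdisj hij with h | h
    · exact absurd (hx.2.trans_le h) hx'.1.not_gt
    · exact absurd (hx'.2.trans_le h) hx.1.not_gt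
  have hsub : (⋃ i, Set.Ioo (s i) (t i)) ⊆ Set.Icc 0 1 :=
    Set.iUnion_subset fun i x hx => ⟨(h0 i).trans hx.1.le, hx.2.le.trans (h1 i)⟩
  have h := MeasureTheory.measure_mono (μ := MeasureTheory.volume) hsub
  rw [MeasureTheory.measure_iUnion hd fun i => measurableSet_Ioo, tsum_fintype,
    Real.volume_Icc, sub_zero] at h
  simp only [Real.volume_Ioo] at h
  rw [← ENNReal.ofReal_sum_of_nonneg fun i _ => sub_nonneg.2 (hst i)] at h
  exact (ENNReal.ofReal_le_ofReal_iff zero_le_one).1 h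

theorem strictMono_or_strictAnti (h : I ≃ₜ I) : StrictMono h ∨ StrictAnti h :=
  h.continuous.strictMono_of_inj h.injective

/-- The conjugacy may reverse orientation, whence the absolute values and unordered intervals
throughout. -/
theorem sum_abs_sub_le_one (h : I ≃ₜ I) {ι : Type} [Fintype ι] {s t : ι → I}
    (hst : ∀ i, s i ≤ t i) (hdisj : Pairwise fun i j => t i ≤ s j ∨ t j ≤ s i) :
    ∑ i, |(h (t i) : ℝ) - h (s i)| ≤ 1 := by
  rcases strictMono_or_strictAnti h with hh | hh
  · have e : ∀ i, |(h (t i) : ℝ) - h (s i)| = (h (t i) : ℝ) - h (s i) := fun i =>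
      abs_of_nonneg (sub_nonneg.2 (hh.monotone (hst i)))
    simp only [e]
    exact sum_length_le_one (s := fun i => (h (s i) : ℝ)) (t := fun i => (h (t i) : ℝ))
      (fun i => (h (s i)).2.1) (fun i => hh.monotone (hst i)) (fun i => (h (t i)).2.2)
      fun i j hij => (hdisj hij).imp (fun h => hh.monotone h) fun h => hh.monotone h
  · have e : ∀ i, |(h (t i) : ℝ) - h (s i)| = (h (s i) : ℝ) - h (t i) := fun i => by
      rw [abs_sub_comm]
      exact abs_of_nonneg (sub_nonneg.2 (hh.antitone (hst i)))
    simp only [e]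
    exact sum_length_le_one (s := fun i => (h (t i) : ℝ)) (t := fun i => (h (s i) : ℝ))
      (fun i => (h (t i)).2.1) (fun i => hh.antitone (hst i)) (fun i => (h (s i)).2.2)
      fun i j hij => (hdisj hij).symm.imp (fun h => hh.antitone h) fun h => hh.antitone h

theorem uIcc_image_subset (h : I ≃ₜ I) {A B p q : I} (hAp : A ≤ p) (hpq : p ≤ q) (hqB : q ≤ B) :
    Set.uIcc (h p : ℝ) (h q) ⊆ Set.uIcc (h A : ℝ) (h B) := by
  rcases strictMono_or_strictAnti h with hh | hh
  · have h1 : (h A : ℝ) ≤ h p := hh.monotone hAp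
    have h2 : (h p : ℝ) ≤ h q := hh.monotone hpq
    have h3 : (h q : ℝ) ≤ h B := hh.monotone hqB
    rw [Set.uIcc_of_le h2, Set.uIcc_of_le (h1.trans (h2.trans h3))]
    exact Set.Icc_subset_Icc h1 h3
  · have h1 : (h p : ℝ) ≤ h A := hh.antitone hAp
    have h2 : (h q : ℝ) ≤ h p := hh.antitone hpq
    have h3 : (h B : ℝ) ≤ h q := hh.antitone hqB
    rw [Set.uIcc_of_ge h2, Set.uIcc_of_ge (h3.trans (h2.trans h1))]
    exact Set.Icc_subset_Icc h3 h1

/-! ### The rows of intervals -/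

section

variable {m : ℕ} {a b : (Fin (m + 1) → ℤ) → I}

/-- The left end-point of the union of the intervals in the row of `v`. -/
noncomputable def rowInf (a : (Fin (m + 1) → ℤ) → I) (v : Fin (m + 1) → ℤ) : I :=
  ⨅ c : ℤ, a (act (central m c) v)

/-- The right end-point of the union of the intervals in the row of `v`. -/
noncomputable def rowSup (b : (Fin (m + 1) → ℤ) → I) (v : Fin (m + 1) → ℤ) : I :=
  ⨆ c : ℤ, b (act (central m c) v)

theorem rowInf_le {v w : Fin (m + 1) → ℤ} (h : SameRow v w) : rowInf a v ≤ a w := by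
  obtain ⟨c, rfl⟩ := exists_act_central_eq h
  exact iInf_le _ c

theorem le_rowSup {v w : Fin (m + 1) → ℤ} (h : SameRow v w) : b w ≤ rowSup b v := by
  obtain ⟨c, rfl⟩ := exists_act_central_eq h
  exact le_iSup (fun c => b (act (central m c) v)) c

theorem sameRow_refl (v : Fin (m + 1) → ℤ) : SameRow v v := fun _ _ => rfl

theorem rowInf_lt_rowSup (hab : IsLexFamily a b) (v : Fin (m + 1) → ℤ) :
    rowInf a v < rowSup b v :=
  (rowInf_le (sameRow_refl v)).trans_lt ((hab.lt v).trans_le (le_rowSup (sameRow_refl v)))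

/-- A central translation only permutes the intervals of a row. -/
theorem rowInf_central (k : ℤ) (v : Fin (m + 1) → ℤ) :
    rowInf a (act (central m k) v) = rowInf a v := by
  simp only [rowInf, act_central_central]
  exact (Equiv.addRight k).iInf_comp (g := fun c => a (act (central m c) v))

theorem rowSup_central (k : ℤ) (v : Fin (m + 1) → ℤ) :
    rowSup b (act (central m k) v) = rowSup b v := by
  simp only [rowSup, act_central_central]
  exact (Equiv.addRight k).iSup_comp (g := fun c => b (act (central m c) v))

/-- The first coordinate where the points differ is not the last, so the whole row of `v` precedes
that of `w`. -/
theorem rowSup_le_rowInf_of_lt (hab : IsLexFamily a b) {v w : Fin (m + 1) → ℤ}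
    (hvw : toLex v < toLex w) (hrow : ¬ SameRow v w) : rowSup b v ≤ rowInf a w := by
  obtain ⟨i, hi, hlt⟩ := hvw
  have him : (i : ℕ) < m := by
    by_contra! hmi
    exact hrow fun j hj => hi j (Fin.lt_def.2 (by omega))
  refine iSup_le fun c => le_iInf fun c' => hab.lex _ _ ⟨i, fun j hj => ?_, ?_⟩
  · have hjm : (j : ℕ) < m := lt_trans (Fin.lt_def.1 hj) him
    change act (central m c) v j = act (central m c') w j
    rw [act_central_of_lt c v hjm, act_central_of_lt c' w hjm]
    exact hi j hj
  · change act (central m c) v i < act (central m c') w i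
    rw [act_central_of_lt c v him, act_central_of_lt c' w him]
    exact hlt

theorem rows_disjoint (hab : IsLexFamily a b) {v w : Fin (m + 1) → ℤ} (hrow : ¬ SameRow v w) :
    rowSup b v ≤ rowInf a w ∨ rowSup b w ≤ rowInf a v := by
  rcases lex_trichotomy v w with h | rfl | h
  · exact Or.inl (rowSup_le_rowInf_of_lt hab h hrow)
  · exact absurd (sameRow_refl v) hrow
  · exact Or.inr (rowSup_le_rowInf_of_lt hab h fun h => hrow fun i hi => (h i hi).symm)

theorem intervals_disjoint (hab : IsLexFamily a b) {v w : Fin (m + 1) → ℤ} (h : v ≠ w) :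
    b v ≤ a w ∨ b w ≤ a v := by
  rcases lex_trichotomy v w with h' | h' | h'
  · exact Or.inl (hab.lex _ _ h')
  · exact absurd h' h
  · exact Or.inr (hab.lex _ _ h')

variable {φ : N (m + 1) →* (I ≃ₜ I)}

theorem map_endpoints (hφ : ∀ g, Monotone (φ g)) (hab : IsLexFamily a b)
    (him : ∀ g v, φ g '' Set.Icc (a v) (b v) = Set.Icc (a (act g v)) (b (act g v)))
    (g : N (m + 1)) (v : Fin (m + 1) → ℤ) :
    φ g (a v) = a (act g v) ∧ φ g (b v) = b (act g v) := by
  have hle := (hab.lt v).le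
  have hle' := (hab.lt (act g v)).le
  have ha : φ g (a v) ∈ Set.Icc (a (act g v)) (b (act g v)) :=
    him g v ▸ Set.mem_image_of_mem _ (Set.left_mem_Icc.2 hle)
  have hb : φ g (b v) ∈ Set.Icc (a (act g v)) (b (act g v)) :=
    him g v ▸ Set.mem_image_of_mem _ (Set.right_mem_Icc.2 hle)
  obtain ⟨x, hx, hxa⟩ : a (act g v) ∈ φ g '' Set.Icc (a v) (b v) :=
    (him g v).symm ▸ Set.left_mem_Icc.2 hle'
  obtain ⟨y, hy, hyb⟩ : b (act g v) ∈ φ g '' Set.Icc (a v) (b v) :=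
    (him g v).symm ▸ Set.right_mem_Icc.2 hle'
  exact ⟨le_antisymm (hxa ▸ hφ g hx.1) ha.1, le_antisymm hb.2 (hyb ▸ hφ g hy.2)⟩

/-- A monotone bijection commutes with infima, and by `act_comm_central` the translates of `v` go to
those of `act g v`. -/
theorem map_rowInf (hφ : ∀ g, Monotone (φ g)) (ha : ∀ g v, φ g (a v) = a (act g v))
    (g : N (m + 1)) (v : Fin (m + 1) → ℤ) : φ g (rowInf a v) = rowInf a (act g v) := by
  have h := (StrictMono.orderIsoOfSurjective (φ g)
    ((hφ g).strictMono_of_injective (φ g).injective) (φ g).surjective).map_iInf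
    fun c : ℤ => a (act (central m c) v)
  simp only [StrictMono.coe_orderIsoOfSurjective, ha, act_comm_central] at h
  exact h

theorem map_rowSup (hφ : ∀ g, Monotone (φ g)) (hb : ∀ g v, φ g (b v) = b (act g v))
    (g : N (m + 1)) (v : Fin (m + 1) → ℤ) : φ g (rowSup b v) = rowSup b (act g v) := by
  have h := (StrictMono.orderIsoOfSurjective (φ g)
    ((hφ g).strictMono_of_injective (φ g).injective) (φ g).surjective).map_iSup
    fun c : ℤ => b (act (central m c) v)
  simp only [StrictMono.coe_orderIsoOfSurjective, hb, act_comm_central] at h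
  exact h

end

/-! ### Deduction of the theorem -/

theorem not_conjugate_of_mul_gt_one {m : ℕ} (hm : 1 ≤ m) {α β : ℝ} (hβ0 : 0 < β) (hβ1 : β ≤ 1)
    (hβα : β ≤ α) (hβ : 1 < β * (((m + 1) * m / 2 : ℕ) : ℝ)) {φ ψ : N (m + 1) →* (I ≃ₜ I)}
    (hφ : IsFarbFranksAction (m + 1) φ) (hψ : ∀ g, IsHolderDiffeo α (ψ g)) :
    ¬ TopConjugate φ ψ := by
  rintro ⟨h, hconj⟩
  obtain ⟨hmono, a, b, hab, him, -⟩ := hφ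
  have ha := fun g v => (map_endpoints hmono hab him g v).1
  have hb := fun g v => (map_endpoints hmono hab him g v).2
  have ea : ∀ g v, h (a (act g v)) = ψ g (h (a v)) := fun g v => by rw [← hconj, ha]
  have eb : ∀ g v, h (b (act g v)) = ψ g (h (b v)) := fun g v => by rw [← hconj, hb]
  have hsub : ∀ {v w}, SameRow v w → Set.uIcc (h (b w) : ℝ) (h (a w)) ⊆
      Set.uIcc (h (rowInf a v) : ℝ) (h (rowSup b v)) := fun hvw => by
    rw [Set.uIcc_comm]
    exact uIcc_image_subset h (rowInf_le hvw) (hab.lt _).le (le_rowSup hvw)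
  refine false_of_distortion (rho := fun v => |(h (b v) : ℝ) - h (a v)|)
    (lam := fun v => |(h (rowSup b v) : ℝ) - h (rowInf a v)|) hm (fun v => ?_)
    (fun v => abs_nonneg _) (fun ι _ x hx => ?_) hβ0 hβ1 hβ (fun n => ?_) (fun g => ?_)
    (fun k => ?_)
  · rw [abs_pos, sub_ne_zero]
    exact fun e => (hab.lt v).ne' (h.injective (Subtype.ext e))
  · exact sum_abs_sub_le_one h (fun i => (rowInf_lt_rowSup hab _).le)
      fun i j hij => rows_disjoint hab (hx hij)
  · rw [← Fin.sum_univ_eq_sum_range (fun k =>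
      |(h (b (act (central m k) 0)) : ℝ) - h (a (act (central m k) 0))|)]
    refine sum_abs_sub_le_one h (fun i => (hab.lt _).le) fun i j hij =>
      intervals_disjoint hab fun e => hij ?_
    have := congrFun e (Fin.last m)
    simp only [act_central, Function.update_self, add_right_inj] at this
    exact Fin.ext (by exact_mod_cast this)
  · obtain ⟨C, hC, hdist⟩ := (hψ g).exists_distortion hβ0 hβα
    refine ⟨C, hC, fun v w hvw => ?_⟩
    simp only [ea, eb]
    -- Both points lie in the image under `h` of the hull of one row, so their distance is at most
    -- `lam v`.
    exact hdist _ _ _ _ _ fun ξ hξ ξ' hξ' => Set.abs_sub_le_of_uIcc_subset_uIcc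
      (Set.uIcc_subset_uIcc (hsub (sameRow_refl v) hξ) (hsub hvw hξ'))
  · obtain ⟨M, hM, hexp⟩ := (hψ (central m k)).exists_expansion hβ0 hβα
    refine ⟨M, hM, fun v => ?_⟩
    simp only [ea, eb]
    refine hexp _ _ _ _ (fun e => (rowInf_lt_rowSup hab v).ne (h.injective e)) ?_ ?_
      (hsub (sameRow_refl v))
    · rw [← hconj, map_rowInf hmono ha, rowInf_central]
    · rw [← hconj, map_rowSup hmono hb, rowSup_central]

end FarbFranks

theorem theoremA (d : ℕ) (hd : 3 ≤ d) (α : ℝ) (hα : 2 / ((d : ℝ) * ((d : ℝ) - 1)) < α)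
    (φ : FarbFranks.N d →* (unitInterval ≃ₜ unitInterval))
    (hφ : FarbFranks.IsFarbFranksAction d φ) :
    ¬ ∃ ψ : FarbFranks.N d →* (unitInterval ≃ₜ unitInterval),
      (∀ g, FarbFranks.IsHolderDiffeo α (ψ g)) ∧ FarbFranks.TopConjugate φ ψ := by
  rintro ⟨ψ, hψ, hconj⟩
  obtain ⟨m, rfl⟩ : ∃ m, d = m + 1 := ⟨d - 1, by omega⟩
  have hm : (2 : ℝ) ≤ m := by exact_mod_cast (by omega : 2 ≤ m)
  have hD : (((m + 1) * m / 2 : ℕ) : ℝ) = ((m : ℝ) + 1) * m / 2 := by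
    -- The natural division is exact, a product of consecutive integers being even.
    rw [Nat.cast_div (by rw [mul_comm]; exact (Nat.even_mul_succ_self m).two_dvd) two_ne_zero]
    push_cast
    rfl
  have hpos : 0 < ((m : ℝ) + 1) * m := by positivity
  push_cast at hα
  rw [add_sub_cancel_right, div_lt_iff₀ hpos] at hα
  have hα0 : 0 < α := pos_of_mul_pos_left (two_pos.trans hα) hpos.le
  refine FarbFranks.not_conjugate_of_mul_gt_one (by omega) (lt_min hα0 one_pos)
    (min_le_right α 1) (min_le_left α 1) ?_ hφ hψ hconj
  rw [hD]
  -- If `β = α`, this is the assumption on `α`. If `β = 1`, it says `(m + 1) * m / 2 > 1`, which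
  -- holds as `d ≥ 3` gives `m ≥ 2`.
  rcases min_choice α 1 with h | h <;> rw [h]
  · linarith
  · nlinarith
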